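/- Let $\mathbb K=\mathbb R$ or $\mathbb C$, let $A$ be a solid unital subring of $\mathbb K^{]0,1]}$ (that is, $(r_\varepsilon)\in A$ and $|s_\varepsilon|\le|r_\varepsilon|$ for all $\varepsilon$ imply $(s_\varepsilon)\in A$) and let $I_A$ be a solid ideal of $A$. For $\Omega\subset\mathbb R^n$ open, let $\mathcal H(\Omega)$, respectively $\mathcal J(\Omega)$, be the set of nets $(u_\varepsilon)_{\varepsilon\in]0,1]}$ in $\mathrm C^\infty(\Omega)$ such that for all compact $K\subset\Omega$ and all $l\in\mathbb N$ the net $p_{K,l}(u_\varepsilon)=\sup_{x\in K,|\alpha|\le l}|\partial^\alpha u_\varepsilon(x)|$ is the net of absolute values of an element of $A$, respectively of $I_A$ (for $\mathcal J(\Omega)$, within $\mathcal H(\Omega)$). Let $\mathcal A(\Omega)=\mathcal H(\Omega)/\mathcal J(\Omega)$, with derivatives and restrictions to hyperplanes $\{t=\mathrm{const}\}$ defined on representatives. Fix $d$ and assume that $(\varepsilon^r)_\varepsilon\in A$ for all $r\ge0$, and that for every open $V\subset\mathbb R^d$ every net in $\mathcal J(V)$ converges to $0$ in $\mathcal D'(V)$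 as $\varepsilon\to0$. For $v=[v_\varepsilon]\in\mathcal A(\mathbb R^d)$, the $(a,\mathcal D')$-singular spectrum (with $a_\varepsilon(r)=\varepsilon^r$) is the set $\mathcal S^{(a,\mathcal D')}(v)$ of all $(x,r)\in\mathbb R^d\times[0,\infty[$ for which there are no open neighbourhood $V$ of $x$ and $T\in\mathcal D'(V)$ with $\varepsilon^r v_\varepsilon|_V\to T$ in $\mathcal D'(V)$ (i.e. $\int\varepsilon^r v_\varepsilon\psi\,dx\to\langle T,\psi\rangle$ for all $\psi\in\mathcal D(V)$) as $\varepsilon\to0$. **Proposition.** Let $u_0,u_1\in\mathcal A(\mathbb R^d)$ and let $u\in\mathcal A(\mathbb R^{d+1})$ be a solution of the Cauchy problem for the $d$-dimensional linear wave equation $$\partial_t^2u-\Delta u=0,\qquad u(\cdot,0)=u_0,\qquad \partial_tu(\cdot,0)=u_1$$ (equalities in $\mathcal A(\mathbb R^{d+1})$ and $\mathcal A(\mathbb R^d)$). Let $I\subset[0,\infty[$ be $\varnothing$, or $\{s\ge 0: s<r\}$ or $\{s\ge 0:s\le r\}$ for some $0\le r\le\infty$. If $\mathcal S^{(a,\mathcal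 D')}(u_0)\subset\mathbb R^d\times I$ and $\mathcal S^{(a,\mathcal D')}(u_1)\subset\mathbb R^d\times I$, then $\mathcal S^{(a,\mathcal D')}(u(\cdot,t))\subset\mathbb R^d\times I$ for all $t\in\mathbb R$. -/

import Mathlib

open Set Filter Topology MeasureTheory TopologicalSpace
open scoped NNReal ENNReal ContDiff

noncomputable section

namespace CEP

/-- The index set `]0,1]`; `ε → 0` is the filter `atBot` on it. -/
abbrev Param : Type := Set.Ioc (0 : ℝ) 1

/-- A solid (unital) subring `A` of `𝕜^]0,1]` together with a solid ideal `I` of `A`. -/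
structure SolidPair (𝕜 : Type*) [RCLike 𝕜] where
  A : Subring (Param → 𝕜)
  solid : ∀ s r : Param → 𝕜, r ∈ A → (∀ ε, ‖s ε‖ ≤ ‖r ε‖) → s ∈ A
  I : Ideal A
  solid_ideal : ∀ s r : A, r ∈ I →
    (∀ ε, ‖(s : Param → 𝕜) ε‖ ≤ ‖(r : Param → 𝕜) ε‖) → s ∈ I

/-- The seminorm `p_{K,l}(f)`, the supremum over `K` of all derivatives of `f` of order at most `l`
(derivatives are taken in the open set `Ω ⊇ K`). The operator norm of the `k`-th derivative is used
as the size of the partial derivatives of order `k`; the two differ by constant factors, which do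
not affect membership in solid sets of nets. -/
def ckSeminorm {𝕜 E : Type*} [RCLike 𝕜] [NormedAddCommGroup E] [NormedSpace ℝ E]
    (Ω : Opens E) (K : Set E) (l : ℕ) (f : E → 𝕜) : ℝ :=
  sSup {y | ∃ x ∈ K, ∃ k ≤ l, y = ‖iteratedFDerivWithin ℝ k f Ω x‖}

section Seminorm

variable {𝕜 E : Type*} [RCLike 𝕜] [NormedAddCommGroup E] [NormedSpace ℝ E]
  {Ω : Opens E} {K : Set E} {l : ℕ} {f g : E → 𝕜}

lemma ckSeminorm_nonneg : 0 ≤ ckSeminorm Ω K l f := by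
  apply Real.sSup_nonneg
  rintro y ⟨x, -, k, -, rfl⟩
  exact norm_nonneg _

lemma ckSeminorm_le {C : ℝ} (hC : 0 ≤ C)
    (h : ∀ x ∈ K, ∀ k ≤ l, ‖iteratedFDerivWithin ℝ k f Ω x‖ ≤ C) : ckSeminorm Ω K l f ≤ C := by
  apply Real.sSup_le _ hC
  rintro y ⟨x, hx, k, hk, rfl⟩
  exact h x hx k hk

lemma le_ckSeminorm (hf : ContDiffOn ℝ ∞ f Ω) (hK : IsCompact K) (hKΩ : K ⊆ Ω)
    {x : E} (hx : x ∈ K) {k : ℕ} (hk : k ≤ l) :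
    ‖iteratedFDerivWithin ℝ k f Ω x‖ ≤ ckSeminorm Ω K l f := by
  refine le_csSup ?_ ⟨x, hx, k, hk, rfl⟩
  have : ∀ k : ℕ, ∃ C, ∀ x ∈ K, ‖iteratedFDerivWithin ℝ k f Ω x‖ ≤ C := fun k =>
    hK.exists_bound_of_continuousOn
      ((hf.continuousOn_iteratedFDerivWithin (by exact_mod_cast le_top)
        Ω.isOpen.uniqueDiffOn).mono hKΩ)
  choose C hC using this
  refine ⟨∑ k ∈ Finset.range (l + 1), |C k|, ?_⟩
  rintro y ⟨x, hx, k, hk, rfl⟩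
  exact ((hC k x hx).trans (le_abs_self _)).trans
    (Finset.single_le_sum (f := fun k => |C k|) (fun _ _ => abs_nonneg _)
      (Finset.mem_range.2 (by omega)))

lemma ckSeminorm_add_le (hf : ContDiffOn ℝ ∞ f Ω) (hg : ContDiffOn ℝ ∞ g Ω)
    (hK : IsCompact K) (hKΩ : K ⊆ Ω) :
    ckSeminorm Ω K l (f + g) ≤ ckSeminorm Ω K l f + ckSeminorm Ω K l g := by
  refine ckSeminorm_le (add_nonneg ckSeminorm_nonneg ckSeminorm_nonneg) fun x hx k hk => ?_
  have hk' : (k : WithTop ℕ∞) ≤ ((⊤ : ℕ∞) : WithTop ℕ∞) := by exact_mod_cast le_top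
  rw [iteratedFDerivWithin_add_apply ((hf.of_le hk') x (hKΩ hx)) ((hg.of_le hk') x (hKΩ hx))
    Ω.isOpen.uniqueDiffOn (hKΩ hx)]
  exact (norm_add_le _ _).trans
    (add_le_add (le_ckSeminorm hf hK hKΩ hx hk) (le_ckSeminorm hg hK hKΩ hx hk))

lemma ckSeminorm_mul_le (hf : ContDiffOn ℝ ∞ f Ω) (hg : ContDiffOn ℝ ∞ g Ω)
    (hK : IsCompact K) (hKΩ : K ⊆ Ω) :
    ckSeminorm Ω K l (f * g) ≤ 2 ^ l * (ckSeminorm Ω K l f * ckSeminorm Ω K l g) := by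
  have h0 : 0 ≤ ckSeminorm Ω K l f * ckSeminorm Ω K l g :=
    mul_nonneg ckSeminorm_nonneg ckSeminorm_nonneg
  refine ckSeminorm_le (by positivity) fun x hx k hk => ?_
  have hk' : (k : WithTop ℕ∞) ≤ ((⊤ : ℕ∞) : WithTop ℕ∞) := by exact_mod_cast le_top
  refine (norm_iteratedFDerivWithin_mul_le hf hg Ω.isOpen.uniqueDiffOn (hKΩ hx) hk').trans ?_
  calc _ ≤ ∑ i ∈ Finset.range (k + 1), (k.choose i : ℝ) *
        (ckSeminorm Ω K l f * ckSeminorm Ω K l g) := by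
        refine Finset.sum_le_sum fun i hi => ?_
        rw [mul_assoc]
        have hi' : i ≤ k := by simpa [Nat.lt_succ_iff] using hi
        gcongr
        · exact ckSeminorm_nonneg
        · exact le_ckSeminorm hf hK hKΩ hx (hi'.trans hk)
        · exact le_ckSeminorm hg hK hKΩ hx ((Nat.sub_le _ _).trans hk)
    _ = 2 ^ k * (ckSeminorm Ω K l f * ckSeminorm Ω K l g) := by
        rw [← Finset.sum_mul]
        congr 1
        exact_mod_cast Nat.sum_range_choose k
    _ ≤ _ := by
        gcongr
        norm_num

lemma ckSeminorm_const_le (c : 𝕜) : ckSeminorm Ω K l (fun _ : E => c) ≤ ‖c‖ := by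
  refine ckSeminorm_le (norm_nonneg _) fun x hx k hk => ?_
  rcases Nat.eq_zero_or_pos k with rfl | h
  · simp
  · rw [iteratedFDerivWithin_const_of_ne h.ne']
    simp

lemma ckSeminorm_fderivWithin_le (v : E) (hf : ContDiffOn ℝ ∞ f Ω)
    (hK : IsCompact K) (hKΩ : K ⊆ Ω) :
    ckSeminorm Ω K l (fun x => fderivWithin ℝ f Ω x v) ≤ ‖v‖ * ckSeminorm Ω K (l + 1) f := by
  refine ckSeminorm_le (mul_nonneg (norm_nonneg _) ckSeminorm_nonneg) fun x hx k hk => ?_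
  have hk' : (k : WithTop ℕ∞) ≤ ((⊤ : ℕ∞) : WithTop ℕ∞) := by exact_mod_cast le_top
  have hu := Ω.isOpen.uniqueDiffOn (𝕜 := ℝ)
  have hd : ContDiffOn ℝ ∞ (fderivWithin ℝ f Ω) Ω := hf.fderivWithin hu (by simp)
  refine (norm_iteratedFDerivWithin_clm_apply_const (hd x (hKΩ hx)) hu (hKΩ hx) hk').trans ?_
  gcongr
  rw [norm_iteratedFDerivWithin_fderivWithin hu (hKΩ hx)]
  exact le_ckSeminorm hf hK hKΩ hx (by omega)

end Seminorm

namespace SolidPair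

variable {𝕜 : Type*} [RCLike 𝕜] (P : SolidPair 𝕜)

/-- `|A|`, the nets of absolute values of elements of `A`. -/
def absA : Set (Param → ℝ) := {b | ∃ r ∈ P.A, ∀ ε, b ε = ‖r ε‖}

/-- `|I|`, the nets of absolute values of elements of `I`. -/
def absI : Set (Param → ℝ) := {b | ∃ r ∈ P.I, ∀ ε, b ε = ‖(r : Param → 𝕜) ε‖}

variable {P}

lemma absA_mono {b c : Param → ℝ} (hc : c ∈ P.absA) (hb : ∀ ε, 0 ≤ b ε) (h : ∀ ε, b ε ≤ c ε) :
    b ∈ P.absA := by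
  obtain ⟨r, hr, hrc⟩ := hc
  refine ⟨fun ε => (b ε : 𝕜), P.solid _ r hr fun ε => ?_, fun ε => ?_⟩
  · rw [RCLike.norm_ofReal, abs_of_nonneg (hb ε), ← hrc]
    exact h ε
  · rw [RCLike.norm_ofReal, abs_of_nonneg (hb ε)]

lemma ofReal_mem {b : Param → ℝ} (hb : b ∈ P.absA) : (fun ε => (b ε : 𝕜)) ∈ P.A := by
  obtain ⟨r, hr, hrb⟩ := hb
  exact P.solid _ r hr fun ε => by simp [hrb]

lemma absA_of_mem {b : Param → ℝ} (hb : ∀ ε, 0 ≤ b ε) (h : (fun ε => (b ε : 𝕜)) ∈ P.A) :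
    b ∈ P.absA :=
  ⟨_, h, fun ε => by simp [abs_of_nonneg (hb ε)]⟩

lemma absA_nonneg {b : Param → ℝ} (hb : b ∈ P.absA) (ε : Param) : 0 ≤ b ε := by
  obtain ⟨r, hr, hrb⟩ := hb
  rw [hrb]
  exact norm_nonneg _

lemma absA_add {b c : Param → ℝ} (hb : b ∈ P.absA) (hc : c ∈ P.absA) :
    (fun ε => b ε + c ε) ∈ P.absA := by
  refine absA_of_mem (fun ε => add_nonneg (absA_nonneg hb ε) (absA_nonneg hc ε)) ?_
  convert P.A.add_mem (ofReal_mem hb) (ofReal_mem hc) using 1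
  ext ε
  simp

lemma absA_mul {b c : Param → ℝ} (hb : b ∈ P.absA) (hc : c ∈ P.absA) :
    (fun ε => b ε * c ε) ∈ P.absA := by
  refine absA_of_mem (fun ε => mul_nonneg (absA_nonneg hb ε) (absA_nonneg hc ε)) ?_
  convert P.A.mul_mem (ofReal_mem hb) (ofReal_mem hc) using 1
  ext ε
  simp

lemma absA_const {C : ℝ} (hC : 0 ≤ C) : (fun _ => C) ∈ P.absA := by
  obtain ⟨n, hn⟩ := exists_nat_ge C
  refine absA_mono (c := fun _ => (n : ℝ)) ⟨(n : Param → 𝕜), natCast_mem P.A n, fun ε => ?_⟩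
    (fun _ => hC) (fun _ => hn)
  simp

lemma absI_subset {b : Param → ℝ} (hb : b ∈ P.absI) : b ∈ P.absA := by
  obtain ⟨r, hr, hrb⟩ := hb
  exact ⟨r, r.2, hrb⟩

lemma absI_mono {b c : Param → ℝ} (hc : c ∈ P.absI) (hb : ∀ ε, 0 ≤ b ε) (h : ∀ ε, b ε ≤ c ε) :
    b ∈ P.absI := by
  have hA : (fun ε => (b ε : 𝕜)) ∈ P.A := ofReal_mem (absA_mono (absI_subset hc) hb h)
  obtain ⟨r, hr, hrc⟩ := hc
  refine ⟨⟨_, hA⟩, P.solid_ideal _ r hr fun ε => ?_, fun ε => ?_⟩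
  · simp only [RCLike.norm_ofReal, abs_of_nonneg (hb ε), ← hrc]
    exact h ε
  · simp only [RCLike.norm_ofReal, abs_of_nonneg (hb ε)]

lemma ofReal_mem_ideal {b : Param → ℝ} (hb : b ∈ P.absI) :
    (⟨fun ε => (b ε : 𝕜), ofReal_mem (absI_subset hb)⟩ : P.A) ∈ P.I := by
  obtain ⟨r, hr, hrb⟩ := id hb
  exact P.solid_ideal _ r hr fun ε => by simp [hrb]

lemma absI_add {b c : Param → ℝ} (hb : b ∈ P.absI) (hc : c ∈ P.absI) :
    (fun ε => b ε + c ε) ∈ P.absI := by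
  refine ⟨_, P.I.add_mem (ofReal_mem_ideal hb) (ofReal_mem_ideal hc), fun ε => ?_⟩
  simp only [Subring.coe_add, Pi.add_apply]
  rw [← RCLike.ofReal_add, RCLike.norm_ofReal, abs_of_nonneg (add_nonneg
    (absA_nonneg (absI_subset hb) ε) (absA_nonneg (absI_subset hc) ε))]

lemma absI_mul {b c : Param → ℝ} (hb : b ∈ P.absA) (hc : c ∈ P.absI) :
    (fun ε => b ε * c ε) ∈ P.absI := by
  refine ⟨_, P.I.mul_mem_left ⟨_, ofReal_mem hb⟩ (ofReal_mem_ideal hc), fun ε => ?_⟩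
  simp only [Subring.coe_mul, Pi.mul_apply]
  rw [← RCLike.ofReal_mul, RCLike.norm_ofReal, abs_of_nonneg (mul_nonneg
    (absA_nonneg hb ε) (absA_nonneg (absI_subset hc) ε))]

lemma absI_zero : (fun _ => (0 : ℝ)) ∈ P.absI :=
  ⟨0, P.I.zero_mem, fun ε => by simp⟩

variable (P) {E : Type*} [NormedAddCommGroup E] [NormedSpace ℝ E]

/-- `H_{(A,C^∞,P)}(Ω)`: nets of functions which are smooth on `Ω` and all of whose seminorms
`p_{K,l}`, `K ⊆ Ω` compact, are nets in `|A|`. The elements of `C^∞(Ω)` are given by functions on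
the whole space which are smooth on `Ω`; the values outside `Ω` are irrelevant, as functions which
agree on `Ω` are identified in the quotient below. -/
def moderate (Ω : Opens E) : Subalgebra 𝕜 (Param → E → 𝕜) where
  carrier := {f | (∀ ε, ContDiffOn ℝ ∞ (f ε) Ω) ∧ ∀ K : Set E, IsCompact K → K ⊆ Ω → ∀ l : ℕ,
    (fun ε => ckSeminorm Ω K l (f ε)) ∈ P.absA}
  add_mem' := by
    rintro f g ⟨hf, hf'⟩ ⟨hg, hg'⟩
    refine ⟨fun ε => (hf ε).add (hg ε), fun K hK hKΩ l => ?_⟩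
    exact absA_mono (absA_add (hf' K hK hKΩ l) (hg' K hK hKΩ l)) (fun ε => ckSeminorm_nonneg)
      (fun ε => ckSeminorm_add_le (hf ε) (hg ε) hK hKΩ)
  mul_mem' := by
    rintro f g ⟨hf, hf'⟩ ⟨hg, hg'⟩
    refine ⟨fun ε => (hf ε).mul (hg ε), fun K hK hKΩ l => ?_⟩
    exact absA_mono (absA_mul (absA_const (C := 2 ^ l) (by positivity))
      (absA_mul (hf' K hK hKΩ l) (hg' K hK hKΩ l))) (fun ε => ckSeminorm_nonneg)
      (fun ε => ckSeminorm_mul_le (hf ε) (hg ε) hK hKΩ)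
  algebraMap_mem' := by
    intro c
    refine ⟨fun ε => contDiffOn_const, fun K hK hKΩ l => ?_⟩
    exact absA_mono (absA_const (norm_nonneg c)) (fun ε => ckSeminorm_nonneg)
      (fun ε => ckSeminorm_const_le c)

/-- `J_{(I,C^∞,P)}(Ω)`: the nets all of whose seminorms are nets in `|I|`. -/
def negligible (Ω : Opens E) : Ideal (P.moderate Ω) where
  carrier := {f | ∀ K : Set E, IsCompact K → K ⊆ Ω → ∀ l : ℕ,
    (fun ε => ckSeminorm Ω K l ((f : Param → E → 𝕜) ε)) ∈ P.absI}
  add_mem' := by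
    intro f g hf hg K hK hKΩ l
    exact absI_mono (absI_add (hf K hK hKΩ l) (hg K hK hKΩ l)) (fun ε => ckSeminorm_nonneg)
      (fun ε => ckSeminorm_add_le (f.2.1 ε) (g.2.1 ε) hK hKΩ)
  zero_mem' := by
    intro K hK hKΩ l
    exact absI_mono absI_zero (fun ε => ckSeminorm_nonneg)
      (fun ε => (ckSeminorm_const_le (0 : 𝕜)).trans (by simp))
  smul_mem' := by
    intro f g hg K hK hKΩ l
    exact absI_mono (absI_mul (absA_const (C := 2 ^ l) (by positivity))
      (absI_mul (f.2.2 K hK hKΩ l) (hg K hK hKΩ l))) (fun ε => ckSeminorm_nonneg)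
      (fun ε => ckSeminorm_mul_le (f.2.1 ε) (g.2.1 ε) hK hKΩ)

/-- The algebra `𝒜(Ω) = H(Ω) / J(Ω)` of generalized functions. -/
abbrev GenFun (Ω : Opens E) := P.moderate Ω ⧸ P.negligible Ω

variable {P} {Ω : Opens E}

/-- The class `[f_ε]`. -/
def cls (f : P.moderate Ω) : P.GenFun Ω := Ideal.Quotient.mk (P.negligible Ω) f

/-- The partial derivative in direction `v` of a net, taken for each `ε`. -/
def netDeriv (v : E) (f : P.moderate Ω) : P.moderate Ω :=
  ⟨fun ε x => fderivWithin ℝ ((f : Param → E → 𝕜) ε) Ω x v, by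
    refine ⟨fun ε => ?_, fun K hK hKΩ l => ?_⟩
    · exact ((f.2.1 ε).fderivWithin Ω.isOpen.uniqueDiffOn (m := ∞) (by simp)).clm_apply
        contDiffOn_const
    · exact absA_mono (absA_mul (absA_const (norm_nonneg v)) (f.2.2 K hK hKΩ (l + 1)))
        (fun ε => ckSeminorm_nonneg) (fun ε => ckSeminorm_fderivWithin_le v (f.2.1 ε) hK hKΩ)⟩

lemma netDeriv_sub_mem (v : E) (f g : P.moderate Ω) (h : f - g ∈ P.negligible Ω) :
    netDeriv v f - netDeriv v g ∈ P.negligible Ω := by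
  have key : netDeriv v f - netDeriv v g - netDeriv v (f - g) ∈ P.negligible Ω := by
    intro K hK hKΩ l
    refine absI_mono absI_zero (fun ε => ckSeminorm_nonneg) fun ε => ckSeminorm_le le_rfl ?_
    intro x hx k hk
    have h0 : EqOn (((netDeriv v f - netDeriv v g - netDeriv v (f - g) : P.moderate Ω) :
        Param → E → 𝕜) ε) (fun _ => 0) Ω := by
      intro y hy
      have hu := Ω.isOpen.uniqueDiffOn (𝕜 := ℝ) y hy
      have hf := (f.2.1 ε).differentiableOn (by simp) y hy
      have hg := (g.2.1 ε).differentiableOn (by simp) y hy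
      have := fderivWithin_sub hu hf hg
      simp [netDeriv, this]
    rw [iteratedFDerivWithin_congr h0 (hKΩ hx)]
    simp
  have key2 : netDeriv v (f - g) ∈ P.negligible Ω := fun K hK hKΩ l =>
    absI_mono (absI_mul (absA_const (norm_nonneg v)) (h K hK hKΩ (l + 1)))
        (fun ε => ckSeminorm_nonneg)
        (fun ε => ckSeminorm_fderivWithin_le v ((f - g).2.1 ε) hK hKΩ)
  simpa using (P.negligible Ω).add_mem key key2

/-- The partial derivative `∂_v : 𝒜(Ω) → 𝒜(Ω)`, `∂_v [f_ε] = [∂_v f_ε]`. -/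
def pderiv (v : E) : P.GenFun Ω → P.GenFun Ω :=
  Quotient.map' (netDeriv v) fun f g h => by
    rw [Submodule.quotientRel_def] at h ⊢
    exact netDeriv_sub_mem v f g h

lemma pderiv_cls (v : E) (f : P.moderate Ω) : pderiv v (cls f) = cls (netDeriv v f) := rfl

lemma ckSeminorm_slice_le {f : E × ℝ → 𝕜} (hf : ContDiffOn ℝ ∞ f (⊤ : Opens (E × ℝ))) (t : ℝ)
    {K : Set E} (hK : IsCompact K) (l : ℕ) :
    ckSeminorm (⊤ : Opens E) K l (fun x => f (x, t)) ≤
      ckSeminorm (⊤ : Opens (E × ℝ)) (K ×ˢ {t}) l f := by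
  refine ckSeminorm_le ckSeminorm_nonneg fun x hx k hk => ?_
  have hk' : (k : WithTop ℕ∞) ≤ ((⊤ : ℕ∞) : WithTop ℕ∞) := by exact_mod_cast le_top
  refine le_trans ?_ (le_ckSeminorm hf (hK.prod isCompact_singleton) (by simp)
    (Set.mk_mem_prod hx rfl) hk)
  have hf' : ContDiff ℝ ∞ f := by simpa [contDiffOn_univ] using hf
  have hft : ContDiff ℝ ∞ (fun z : E × ℝ => f (z + (0, t))) :=
    hf'.comp (contDiff_id.add contDiff_const)
  have e : (fun x : E => f (x, t)) =
      (fun z : E × ℝ => f (z + (0, t))) ∘ ContinuousLinearMap.inl ℝ E ℝ := by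
    ext y
    simp
  simp only [Opens.coe_top, iteratedFDerivWithin_univ]
  rw [e, ContinuousLinearMap.iteratedFDeriv_comp_right _ hft x hk', iteratedFDeriv_comp_add_right]
  refine (ContinuousMultilinearMap.norm_compContinuousLinearMap_le _ _).trans ?_
  have h1 : ‖ContinuousLinearMap.inl ℝ E ℝ‖ ≤ 1 := ContinuousLinearMap.norm_inl_le_one ℝ E ℝ
  have h2 : ∏ _i : Fin k, ‖ContinuousLinearMap.inl ℝ E ℝ‖ ≤ 1 :=
    Finset.prod_le_one (fun _ _ => norm_nonneg _) fun _ _ => h1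
  simpa using mul_le_mul_of_nonneg_left h2 (norm_nonneg (iteratedFDeriv ℝ k f (x, t)))

/-- The restriction of a net on `E × ℝ` to the slice at time `t`. -/
def netSlice (t : ℝ) (f : P.moderate (⊤ : Opens (E × ℝ))) : P.moderate (⊤ : Opens E) :=
  ⟨fun ε x => (f : Param → E × ℝ → 𝕜) ε (x, t), by
    refine ⟨fun ε => ?_, fun K hK hKΩ l => ?_⟩
    · exact (f.2.1 ε).comp (contDiff_id.prodMk contDiff_const).contDiffOn (by intro x _; simp)
    · exact absA_mono (f.2.2 (K ×ˢ {t}) (hK.prod isCompact_singleton) (by simp) l)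
        (fun ε => ckSeminorm_nonneg) (fun ε => ckSeminorm_slice_le (f.2.1 ε) t hK l)⟩

lemma netSlice_sub_mem (t : ℝ) (f g : P.moderate (⊤ : Opens (E × ℝ)))
    (h : f - g ∈ P.negligible ⊤) : netSlice t f - netSlice t g ∈ P.negligible ⊤ := by
  have e : netSlice t f - netSlice t g = netSlice t (f - g) := rfl
  rw [e]
  intro K hK hKΩ l
  exact absI_mono (h (K ×ˢ {t}) (hK.prod isCompact_singleton) (by simp) l)
    (fun ε => ckSeminorm_nonneg) (fun ε => ckSeminorm_slice_le ((f - g).2.1 ε) t hK l)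

/-- The restriction `u ↦ u(·,t)`, `𝒜(E × ℝ) → 𝒜(E)`. -/
def slice (t : ℝ) : P.GenFun (⊤ : Opens (E × ℝ)) → P.GenFun (⊤ : Opens E) :=
  Quotient.map' (netSlice t) fun f g h => by
    rw [Submodule.quotientRel_def] at h ⊢
    exact netSlice_sub_mem t f g h

lemma slice_cls (t : ℝ) (f : P.moderate (⊤ : Opens (E × ℝ))) :
    slice t (cls f) = cls (netSlice t f) := rfl

end SolidPair

/-- `ℝ^d`. -/
abbrev Rd (d : ℕ) : Type := EuclideanSpace ℝ (Fin d)

/-- The scale `a_ε(r) = ε^r`. -/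
def scale (r : ℝ≥0) (ε : Param) : ℝ := (ε : ℝ) ^ (r : ℝ)

/-- `v_ε → T` in `𝒟'(V)` as `ε → 0`: convergence when tested on each test function on `V`. -/
def TendstoDistr {𝕜 : Type*} [RCLike 𝕜] {d : ℕ} (V : Opens (Rd d)) (v : Param → Rd d → 𝕜)
    (T : Distribution V 𝕜 ⊤) : Prop :=
  ∀ ψ : TestFunction V ℝ ⊤, Tendsto (fun ε : Param => ∫ x, ψ x • v ε x) atBot (𝓝 (T ψ))

namespace SolidPair

variable {𝕜 : Type*} [RCLike 𝕜] {P : SolidPair 𝕜} {d : ℕ} {Ω : Opens (Rd d)}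

/-- `N_x(u)`: the `r ≥ 0` for which `ε^r u_ε` converges in `𝒟'(V)` for some open neighbourhood `V`
of `x`. -/
def regularExponents (u : P.GenFun Ω) (x : Rd d) : Set ℝ≥0 :=
  {r | ∃ f : P.moderate Ω, cls f = u ∧ ∃ V : Opens (Rd d), x ∈ V ∧ V ≤ Ω ∧
    ∃ T : Distribution V 𝕜 ⊤,
      TendstoDistr V (fun ε y => scale r ε • (f : Param → Rd d → 𝕜) ε y) T}

/-- The `(a, 𝒟')`-singular spectrum of `u ∈ 𝒜(Ω)`. -/
def singularSpectrum (u : P.GenFun Ω) : Set (Rd d × ℝ≥0) :=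
  {p | p.1 ∈ Ω ∧ p.2 ∉ regularExponents u p.1}

/-- `u ∈ 𝒜(ℝ^d × ℝ)` solves `∂_t² u - Δu = 0`, `u(·,0) = u₀`, `∂_t u(·,0) = u₁`, all equalities
being equalities in the algebras `𝒜(ℝ^d × ℝ)` and `𝒜(ℝ^d)`. -/
structure IsWaveSolution (u : P.GenFun (⊤ : Opens (Rd d × ℝ)))
    (u₀ u₁ : P.GenFun (⊤ : Opens (Rd d))) : Prop where
  wave : pderiv (0, 1) (pderiv (0, 1) u) -
    ∑ i : Fin d, pderiv (EuclideanSpace.single i 1, 0)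
      (pderiv (EuclideanSpace.single i 1, 0) u) = 0
  init : slice 0 u = u₀
  init_deriv : slice 0 (pderiv (0, 1) u) = u₁

end SolidPair

end CEP

end

/-!
The proof is by duality with the Cauchy problem. Given a test function `ψ`, let `W` be the smooth
solution of the wave equation with `W(·,t) = 0` and `∂_t W(·,t) = ψ`. If `f_ε` represents `u`,
Green's identity expresses `∫ ψ f_ε(·,t)` through the pairings of `∂_t W(·,0)` and `W(·,0)` with
`f_ε(·,0)` and `∂_t f_ε(·,0)`, up to the integral of `W (∂_t² - Δ) f_ε` over the time interval. The
source `(∂_t² - Δ) f_ε` is negligible, hence tends to `0` uniformly on compact sets, because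
constant negligible nets are null. So `ε^r ∫ ψ f_ε(·,t)` converges as soon as `ε^r` regularizes both
data near the supports of `W(·,0)` and `∂_t W(·,0)`, and by the Banach–Steinhaus theorem, applied on
the Fréchet spaces of smooth functions supported in a fixed compact set, the limit is a distribution
in `ψ`.

In every dimension, `t ∫ g(ξ) ∫_{-1}^{1} exp (2πi (⟪ξ, x⟫ + σ ‖ξ‖ t)) dσ dξ` solves the wave
equation: its quotient `w` by `t` satisfies `2 ∂_t w + t (∂_t² - Δ) w = 0`, the
Euler–Poisson–Darboux equation. The solution `W` is such a function, translated in time, and its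
support is controlled by integrating the energy density against a smooth cutoff which decreases
along the light cone.
-/

open scoped Distributions

noncomputable section

namespace CEP

/-! ### Distributions as limits of functions -/

section Distributions

variable {E F ι : Type*} [NormedAddCommGroup E] [NormedSpace ℝ E] [NormedAddCommGroup F]
  [NormedSpace ℝ F] {L : Filter ι}

lemma hasFTaylorSeriesUpTo_of_tendstoUniformly [L.NeBot] {f : ι → E → F}
    (hf : ∀ n, ContDiff ℝ ∞ (f n)) {p : E → FormalMultilinearSeries ℝ E F}
    (h : ∀ k, TendstoUniformly (fun n => iteratedFDeriv ℝ k (f n)) (fun x => p x k) L) :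
    HasFTaylorSeriesUpTo ∞ (fun x => p x 0 0) p where
  zero_eq _ := rfl
  fderiv k _ x := by
    have hcurry : TendstoUniformly (fun n x => (iteratedFDeriv ℝ (k + 1) (f n) x).curryLeft)
        (fun x => (p x (k + 1)).curryLeft) L :=
      (continuousMultilinearCurryLeftEquiv ℝ (fun _ : Fin (k + 1) => E)
        F).isometry.uniformContinuous.comp_tendstoUniformly (h (k + 1))
    refine hasFDerivAt_of_tendstoUniformly hcurry (fun n y => ?_) (fun y => (h k).tendsto_at y) x
    exact ((hf n).differentiable_iteratedFDeriv (m := k)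
      (by exact_mod_cast ENat.natCast_lt_top k) y).hasFDerivAt
  cont k _ := (h k).continuous <| Frequently.of_forall fun n =>
    (hf n).continuous_iteratedFDeriv (m := k) (by exact_mod_cast le_top)

lemma isClosed_range_pi_structureMapCLM (K : Compacts E) :
    IsClosed (range (ContinuousLinearMap.pi (ContDiffMapSupportedIn.structureMapCLM ℝ ⊤) :
      𝓓^{⊤}_{K}(E, F) →L[ℝ] Π k : ℕ, BoundedContinuousFunction E (E [×k]→L[ℝ] F))) := by
  refine IsSeqClosed.isClosed fun u g hu hg => ?_
  choose f hf using hu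
  have hfu (n k) : iteratedFDeriv ℝ k (f n) = u n k := by
    ext1 x
    simp [← hf n, ContDiffMapSupportedIn.structureMapCLM_apply]
  have hunif (k) : TendstoUniformly (fun n => iteratedFDeriv ℝ k (f n)) (g k) atTop := by
    simpa only [hfu] using BoundedContinuousFunction.tendsto_iff_tendstoUniformly.1
      (tendsto_pi_nhds.1 hg k)
  have htaylor := hasFTaylorSeriesUpTo_of_tendstoUniformly (p := fun x k => g k x)
    (fun n => (f n).contDiff) hunif
  have hsupp : EqOn (fun x => g 0 x 0) 0 (K : Set E)ᶜ := fun x hx => by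
    have hlim : Tendsto (fun n => iteratedFDeriv ℝ 0 (f n) x 0) atTop (𝓝 (g 0 x 0)) :=
      ((ContinuousMultilinearMap.apply ℝ (fun _ : Fin 0 => E) F 0).continuous.tendsto _).comp
        ((hunif 0).tendsto_at x)
    have hzero (n) : f n x = 0 := (f n).zero_on_compl hx
    simp only [iteratedFDeriv_zero_apply, hzero] at hlim
    exact tendsto_nhds_unique hlim tendsto_const_nhds
  refine ⟨⟨fun x => g 0 x 0, htaylor.contDiff, hsupp⟩, ?_⟩
  ext1 k
  ext1 x
  rw [ContinuousLinearMap.coe_pi', ContDiffMapSupportedIn.structureMapCLM_apply]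
  simp only [le_top, ↓reduceIte]
  exact (htaylor.eq_iteratedFDeriv (by exact_mod_cast le_top) x).symm

instance barrelledSpace_contDiffMapSupportedIn [CompleteSpace F] {K : Compacts E} :
    BarrelledSpace ℝ 𝓓^{⊤}_{K}(E, F) := by
  have hemb : IsClosedEmbedding _ :=
    ⟨(ContDiffMapSupportedIn.isUniformEmbedding_pi_structureMapCLM ℝ
      (n := ⊤) (K := K) (E := E) (F := F)).isEmbedding, isClosed_range_pi_structureMapCLM K⟩
  have := hemb.IsCompletelyPseudoMetrizableSpace
  infer_instance

variable [MeasurableSpace E] {μ : Measure E}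

/-- By the Banach–Steinhaus theorem on the Fréchet spaces of test functions supported in a fixed
compact set. -/
lemma exists_distribution_of_tendsto_integral [OpensMeasurableSpace E] [L.IsCountablyGenerated]
    [L.NeBot] {V : Opens E} {v : ι → E → F} (hv : ∀ n, LocallyIntegrableOn (v n) V μ)
    (h : ∀ ψ : 𝓓(V, ℝ), ∃ l, Tendsto (fun n => ∫ x, ψ x • v n x ∂μ) L (𝓝 l)) :
    ∃ T : 𝓓'(V, F), ∀ ψ : 𝓓(V, ℝ), Tendsto (fun n => ∫ x, ψ x • v n x ∂μ) L (𝓝 (T ψ)) := by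
  choose T hT using h
  let g (n : ι) : 𝓓(V, ℝ) →L[ℝ] F :=
    TestFunction.integralAgainstBilinCLM (ContinuousLinearMap.lsmul ℝ ℝ) μ (v n)
  have hlim : Tendsto (fun n ψ => g n ψ) L (𝓝 T) := tendsto_pi_nhds.2 fun ψ =>
    (hT ψ).congr fun n => (TestFunction.integralAgainstBilinCLM_eq_integral (hv n)).symm
  let Tlin : 𝓓(V, ℝ) →ₗ[ℝ] F := linearMapOfTendsto T (fun n => (g n).toLinearMap) hlim
  have hcont : Continuous Tlin := by
    rw [TestFunction.continuous_iff_continuous_comp]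
    intro K hK
    have hlimK : Tendsto (fun n f => (g n).comp (TestFunction.ofSupportedInCLM ℝ hK) f) L
        (𝓝 fun f => T (TestFunction.ofSupportedIn hK f)) :=
      tendsto_pi_nhds.2 fun f => tendsto_pi_nhds.1 hlim _
    exact (continuousLinearMapOfTendsto _ hlimK).continuous
  exact ⟨⟨Tlin, hcont⟩, hT⟩

open scoped Manifold in
lemma exists_tendsto_integral_of_locally [FiniteDimensional ℝ E] [OpensMeasurableSpace E]
    {v : ι → E → F} (hv : ∀ n, LocallyIntegrable (v n) μ)
    {ψ : E → ℝ} (hψ : ContDiff ℝ ∞ ψ) (hψc : HasCompactSupport ψ)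
    (h : ∀ x ∈ tsupport ψ, ∃ V : Opens E, x ∈ V ∧ ∀ φ : 𝓓(V, ℝ),
      ∃ l, Tendsto (fun n => ∫ x, φ x • v n x ∂μ) L (𝓝 l)) :
    ∃ l, Tendsto (fun n => ∫ x, ψ x • v n x ∂μ) L (𝓝 l) := by
  choose V hxV hV using h
  obtain ⟨ρ, hρ⟩ := SmoothPartitionOfUnity.exists_isSubordinate 𝓘(ℝ, E) (isClosed_tsupport ψ)
    (fun x : tsupport ψ => (V x x.2 : Set E)) (fun x => (V x x.2).isOpen)
    (fun x hx => mem_iUnion.2 ⟨⟨x, hx⟩, hxV x hx⟩)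
  have hfin := ρ.locallyFinite.finite_nonempty_inter_compact hψc
  have hsum (x) : ∑ i ∈ hfin.toFinset, ρ i x * ψ x = ψ x := by
    by_cases hx : ψ x = 0
    · simp [hx]
    · have hsupp : (Function.support fun i => ρ i x) ⊆ hfin.toFinset := fun i hi => by
        simpa using ⟨x, hi, subset_tsupport _ hx⟩
      rw [← Finset.sum_mul, ← finsum_eq_sum_of_support_subset _ hsupp,
        ρ.sum_eq_one (subset_tsupport _ hx), one_mul]
  have hρψ (i) : ContDiff ℝ ∞ fun x => ρ i x * ψ x := (ρ i).contMDiff.contDiff.mul hψ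
  have hρψc (i) : HasCompactSupport fun x => ρ i x * ψ x := hψc.mul_left
  have hlim (i) : ∃ l, Tendsto (fun n => ∫ x, (ρ i x * ψ x) • v n x ∂μ) L (𝓝 l) :=
    hV i i.2 ⟨fun x => ρ i x * ψ x, hρψ i, hρψc i,
      (closure_mono (Function.support_mul_subset_left _ _)).trans (hρ i)⟩
  choose l hl using hlim
  refine ⟨∑ i ∈ hfin.toFinset, l i, (tendsto_finsetSum _ fun i _ => hl i).congr fun n => ?_⟩
  rw [← integral_finsetSum _ fun i _ =>
    (hv n).integrable_smul_left_of_hasCompactSupport (hρψ i).continuous (hρψc i)]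
  simp_rw [← Finset.sum_smul, hsum]

end Distributions

/-! ### Directional derivatives on space-time and integrals over time slices -/

section DirDeriv

variable {X G : Type*} [NormedAddCommGroup X] [NormedSpace ℝ X] [NormedAddCommGroup G]
  [NormedSpace ℝ G]

/-- The derivative `∂_v F`, as a function on the whole space. -/
def dirDeriv (v : X) (F : X → G) (z : X) : G := fderiv ℝ F z v

lemma contDiff_dirDeriv {n m : ℕ∞ω} {F : X → G} (hF : ContDiff ℝ n F) (h : m + 1 ≤ n) (v : X) :
    ContDiff ℝ m (dirDeriv v F) :=
  (hF.fderiv_right h).clm_apply contDiff_const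

lemma continuous_dirDeriv {F : X → G} (hF : ContDiff ℝ 1 F) (v : X) :
    Continuous (dirDeriv v F) :=
  (contDiff_dirDeriv (m := 0) hF (by simp) v).continuous

variable (v : X) {z : X}

lemma dirDeriv_add {f g : X → G} (hf : DifferentiableAt ℝ f z) (hg : DifferentiableAt ℝ g z) :
    dirDeriv v (fun z => f z + g z) z = dirDeriv v f z + dirDeriv v g z := by
  simp [dirDeriv, fderiv_fun_add hf hg]

lemma dirDeriv_sub {f g : X → G} (hf : DifferentiableAt ℝ f z) (hg : DifferentiableAt ℝ g z) :
    dirDeriv v (fun z => f z - g z) z = dirDeriv v f z - dirDeriv v g z := by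
  simp [dirDeriv, fderiv_fun_sub hf hg]

lemma dirDeriv_sum {ι : Type*} (s : Finset ι) {f : ι → X → G}
    (hf : ∀ i ∈ s, DifferentiableAt ℝ (f i) z) :
    dirDeriv v (fun z => ∑ i ∈ s, f i z) z = ∑ i ∈ s, dirDeriv v (f i) z := by
  simp [dirDeriv, fderiv_fun_sum hf]

lemma dirDeriv_smul {f : X → ℝ} {g : X → G} (hf : DifferentiableAt ℝ f z)
    (hg : DifferentiableAt ℝ g z) :
    dirDeriv v (fun z => f z • g z) z = f z • dirDeriv v g z + dirDeriv v f z • g z := by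
  simp [dirDeriv, fderiv_fun_smul hf hg]

lemma dirDeriv_mul {f g : X → ℝ} (hf : DifferentiableAt ℝ f z) (hg : DifferentiableAt ℝ g z) :
    dirDeriv v (fun z => f z * g z) z = f z * dirDeriv v g z + dirDeriv v f z * g z :=
  dirDeriv_smul v hf hg

lemma dirDeriv_sq {f : X → ℝ} (hf : DifferentiableAt ℝ f z) :
    dirDeriv v (fun z => f z ^ 2) z = 2 * f z * dirDeriv v f z := by
  simp only [sq]
  rw [dirDeriv_mul v hf hf]
  ring

lemma dirDeriv_const_mul {f : X → ℝ} (hf : DifferentiableAt ℝ f z) (c : ℝ) :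
    dirDeriv v (fun z => c * f z) z = c * dirDeriv v f z := by
  simp [dirDeriv, fderiv_const_mul hf]

lemma dirDeriv_clm_comp {H : Type*} [NormedAddCommGroup H] [NormedSpace ℝ H] (L : G →L[ℝ] H)
    {f : X → G} (hf : Differentiable ℝ f) :
    dirDeriv v (fun z => L (f z)) = fun z => L (dirDeriv v f z) := by
  funext z
  have h : HasFDerivAt (fun z => L (f z)) _ z := L.hasFDerivAt.comp z (hf z).hasFDerivAt
  simp [dirDeriv, h.fderiv]

lemma dirDeriv_comp_add_right (f : X → G) (a : X) :
    dirDeriv v (fun z => f (z + a)) = fun z => dirDeriv v f (z + a) := by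
  funext z
  simp [dirDeriv, fderiv_comp_add_right]

lemma dirDeriv_comm {f : X → G} (hf : ContDiff ℝ 2 f) (v w z : X) :
    dirDeriv v (dirDeriv w f) z = dirDeriv w (dirDeriv v f) z := by
  have hd : DifferentiableAt ℝ (fderiv ℝ f) z :=
    (hf.fderiv_right (m := 1) (by norm_num)).differentiable one_ne_zero z
  have hsnd (a b : X) : dirDeriv a (dirDeriv b f) z = fderiv ℝ (fderiv ℝ f) z a b := by
    have h : HasFDerivAt (dirDeriv b f) _ z := hd.hasFDerivAt.clm_apply (hasFDerivAt_const b z)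
    simp [dirDeriv, h.fderiv]
  rw [hsnd, hsnd]
  exact hf.contDiffAt.isSymmSndFDerivAt (by simp) v w

end DirDeriv

section Slices

variable {E G H : Type*} [NormedAddCommGroup E] [NormedAddCommGroup G] [NormedAddCommGroup H]

/-- The restriction of `F` to each bounded time interval has bounded support. -/
def SpatiallyCompact (F : E × ℝ → G) : Prop :=
  ∀ T : ℝ, ∃ R : ℝ, ∀ x t, |t| ≤ T → R < ‖x‖ → F (x, t) = 0

lemma SpatiallyCompact.mono {F : E × ℝ → G} {F' : E × ℝ → H} (hF : SpatiallyCompact F)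
    (h : ∀ z, F z = 0 → F' z = 0) : SpatiallyCompact F' := fun T => by
  obtain ⟨R, hR⟩ := hF T
  exact ⟨R, fun x t ht hx => h _ (hR x t ht hx)⟩

lemma SpatiallyCompact.sub {F F' : E × ℝ → G} (hF : SpatiallyCompact F)
    (hF' : SpatiallyCompact F') : SpatiallyCompact (fun z => F z - F' z) := fun T => by
  obtain ⟨R, hR⟩ := hF T
  obtain ⟨R', hR'⟩ := hF' T
  refine ⟨max R R', fun x t ht hx => ?_⟩
  simp [hR x t ht ((le_max_left _ _).trans_lt hx), hR' x t ht ((le_max_right _ _).trans_lt hx)]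

lemma SpatiallyCompact.hasCompactSupport_slice [ProperSpace E] {F : E × ℝ → G}
    (hF : SpatiallyCompact F) (t : ℝ) : HasCompactSupport fun x => F (x, t) := by
  obtain ⟨R, hR⟩ := hF |t|
  refine HasCompactSupport.intro (isCompact_closedBall (0 : E) R) fun x hx => hR x t le_rfl ?_
  simpa using hx

lemma SpatiallyCompact.integrable_slice [ProperSpace E] [MeasurableSpace E]
    [OpensMeasurableSpace E] {μ : Measure E} [IsFiniteMeasureOnCompacts μ] {F : E × ℝ → G}
    (hF : SpatiallyCompact F) (hc : Continuous F) (t : ℝ) : Integrable (fun x => F (x, t)) μ :=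
  Continuous.integrable_of_hasCompactSupport (by fun_prop) (hF.hasCompactSupport_slice t)

/-- The unit vector in the direction of time. -/
def timeVec : E × ℝ := (0, 1)

variable [NormedSpace ℝ E] [NormedSpace ℝ G]

lemma SpatiallyCompact.dirDeriv {F : E × ℝ → G} (hF : SpatiallyCompact F) (v : E × ℝ) :
    SpatiallyCompact (dirDeriv v F) := fun T => by
  obtain ⟨R, hR⟩ := hF (T + 1)
  refine ⟨R, fun x t ht hx => ?_⟩
  have ho : IsOpen {z : E × ℝ | |z.2| < T + 1 ∧ R < ‖z.1‖} :=
    (isOpen_lt (continuous_abs.comp continuous_snd) continuous_const).and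
      (isOpen_lt continuous_const continuous_fst.norm)
  have hxt : (x, t) ∈ {z : E × ℝ | |z.2| < T + 1 ∧ R < ‖z.1‖} := ⟨by simp only; linarith, hx⟩
  have hF0 : F =ᶠ[𝓝 (x, t)] fun _ => 0 := by
    filter_upwards [ho.mem_nhds hxt] with z hz using hR z.1 z.2 hz.1.le hz.2
  simp [CEP.dirDeriv, hF0.fderiv_eq]

lemma dirDeriv_snd (v z : E × ℝ) : dirDeriv v Prod.snd z = v.2 := by
  simp [CEP.dirDeriv, fderiv_snd]

lemma hasDerivAt_time {F : E × ℝ → G} (hF : Differentiable ℝ F) (x : E) (t : ℝ) :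
    HasDerivAt (fun s => F (x, s)) (dirDeriv timeVec F (x, t)) t := by
  have h := (hF (x, t)).hasFDerivAt.comp_hasDerivAt t
    ((hasDerivAt_const t x).prodMk (hasDerivAt_id t))
  simpa [dirDeriv, timeVec, Function.comp_def] using h

lemma fderiv_slice {F : E × ℝ → G} (hF : Differentiable ℝ F) (x v : E) (t : ℝ) :
    fderiv ℝ (fun y => F (y, t)) x v = dirDeriv (v, 0) F (x, t) := by
  have h := (hF (x, t)).hasFDerivAt.comp (f := fun y => (y, t)) x
    ((hasFDerivAt_id x).prodMk (hasFDerivAt_const t x))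
  rw [Function.comp_def] at h
  simp [dirDeriv, h.fderiv]

variable [FiniteDimensional ℝ E] [MeasurableSpace E] [BorelSpace E] {μ : Measure E}

lemma hasDerivAt_integral_slice [IsFiniteMeasureOnCompacts μ] {F : E × ℝ → G}
    (hF : ContDiff ℝ 1 F) (hc : SpatiallyCompact F) (t : ℝ) :
    HasDerivAt (fun s => ∫ x, F (x, s) ∂μ) (∫ x, dirDeriv timeVec F (x, t) ∂μ) t := by
  have hD := continuous_dirDeriv hF timeVec
  obtain ⟨R, hR⟩ := (hc.dirDeriv timeVec) (|t| + 1)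
  obtain ⟨C, hC⟩ := ((isCompact_closedBall (0 : E) R).prod
    (isCompact_Icc (a := -(|t| + 1)) (b := |t| + 1))).exists_bound_of_continuousOn hD.continuousOn
  have hbound (x : E) (s : ℝ) (hs : s ∈ Metric.ball t 1) : ‖dirDeriv timeVec F (x, s)‖ ≤
      (Metric.closedBall (0 : E) R).indicator (fun _ => C) x := by
    have hs' : |s| ≤ |t| + 1 := by
      rw [Metric.mem_ball, Real.dist_eq] at hs
      linarith [abs_sub_abs_le_abs_sub s t]
    by_cases hx : x ∈ Metric.closedBall (0 : E) R
    · rw [indicator_of_mem hx]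
      exact hC (x, s) ⟨hx, abs_le.1 hs'⟩
    · rw [indicator_of_notMem hx, hR x s hs' (by simpa using hx), norm_zero]
  have hint : Integrable ((Metric.closedBall (0 : E) R).indicator fun _ => C) μ := by
    rw [integrable_indicator_iff Metric.isClosed_closedBall.measurableSet]
    exact integrableOn_const (isCompact_closedBall (0 : E) R).measure_lt_top.ne
  exact (hasDerivAt_integral_of_dominated_loc_of_deriv_le (F := fun s x => F (x, s))
    (F' := fun s x => dirDeriv timeVec F (x, s)) (Metric.ball_mem_nhds t one_pos)
    (Eventually.of_forall fun s => (hc.integrable_slice hF.continuous s).1)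
    (hc.integrable_slice hF.continuous t) ((hc.dirDeriv _).integrable_slice hD t).1
    (Eventually.of_forall hbound) hint
    (Eventually.of_forall fun x s _ => hasDerivAt_time (hF.differentiable one_ne_zero) x s)).2

variable [μ.IsAddHaarMeasure]

lemma integral_dirDeriv_space {F : E × ℝ → G} (hF : ContDiff ℝ 1 F)
    (hc : SpatiallyCompact F) (v : E) (t : ℝ) : ∫ x, dirDeriv (v, 0) F (x, t) ∂μ = 0 := by
  have hd := hF.differentiable one_ne_zero
  have h := integral_smul_fderiv_eq_neg_fderiv_smul_of_integrable (μ := μ)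
    (f := fun _ : E => (1 : ℝ)) (g := fun y => F (y, t)) (v := v) (by simp)
    (by simpa [fderiv_slice hd] using
      (hc.dirDeriv _).integrable_slice (continuous_dirDeriv hF (v, 0)) t)
    (by simpa using hc.integrable_slice hF.continuous t) (by simp)
    (fun x _ => (hd.comp (differentiable_id.prodMk (differentiable_const t))) x)
  simpa [fderiv_slice hd] using h

variable {ι : Type*} [Fintype ι] {v : ι → E} {F : E × ℝ → G} {J : ι → E × ℝ → G}

lemma hasDerivAt_integral_slice_flux (hF : ContDiff ℝ 1 F) (hc : SpatiallyCompact F)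
    (hJ : ∀ i, ContDiff ℝ 1 (J i)) (hJc : ∀ i, SpatiallyCompact (J i)) (t : ℝ) :
    HasDerivAt (fun s => ∫ x, F (x, s) ∂μ)
      (∫ x, (dirDeriv timeVec F (x, t) - ∑ i, dirDeriv (v i, 0) (J i) (x, t)) ∂μ) t := by
  have hint (i) : Integrable (fun x => dirDeriv (v i, 0) (J i) (x, t)) μ :=
    ((hJc i).dirDeriv _).integrable_slice (continuous_dirDeriv (hJ i) _) t
  rw [integral_sub ((hc.dirDeriv _).integrable_slice (continuous_dirDeriv hF _) t)
    (integrable_finsetSum _ fun i _ => hint i), integral_finsetSum _ fun i _ => hint i]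
  simpa only [integral_dirDeriv_space (hJ _) (hJc _), Finset.sum_const_zero, sub_zero]
    using hasDerivAt_integral_slice hF hc t

lemma hasDerivAt_integral_slice_of_conservation (hF : ContDiff ℝ 1 F)
    (hJ : ∀ i, ContDiff ℝ 1 (J i))
    (hcons : ∀ z, dirDeriv timeVec F z = ∑ i, dirDeriv (v i, 0) (J i) z)
    {η : E × ℝ → ℝ} (hη : ContDiff ℝ 1 η) (hηc : SpatiallyCompact η) (t : ℝ) :
    HasDerivAt (fun s => ∫ x, η (x, s) • F (x, s) ∂μ)
      (∫ x, (dirDeriv timeVec η (x, t) • F (x, t) -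
        ∑ i, dirDeriv (v i, 0) η (x, t) • J i (x, t)) ∂μ) t := by
  have hd := hη.differentiable one_ne_zero
  have hbalance (z) : dirDeriv timeVec η z • F z - ∑ i, dirDeriv (v i, 0) η z • J i z =
      dirDeriv timeVec (fun z => η z • F z) z -
        ∑ i, dirDeriv (v i, 0) (fun z => η z • J i z) z := by
    simp only [dirDeriv_smul _ (hd _) (hF.differentiable one_ne_zero _),
      dirDeriv_smul _ (hd _) ((hJ _).differentiable one_ne_zero _), hcons, Finset.sum_add_distrib,
      Finset.smul_sum]
    abel
  simp only [hbalance]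
  exact hasDerivAt_integral_slice_flux (hη.smul hF) (hηc.mono fun z hz => by simp [hz])
    (fun i => hη.smul (hJ i)) (fun i => hηc.mono fun z hz => by simp [hz]) t

end Slices

/-! ### Finite speed of propagation -/

section WaveOperator

variable {d : ℕ} {G : Type*} [NormedAddCommGroup G] [NormedSpace ℝ G]

/-- The `i`-th unit vector of space, in space-time. -/
def spaceVec (i : Fin d) : Rd d × ℝ := (EuclideanSpace.single i 1, 0)

/-- The wave operator `∂_t² - Δ`. -/
def waveOp (w : Rd d × ℝ → G) (z : Rd d × ℝ) : G :=
  dirDeriv timeVec (dirDeriv timeVec w) z -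
    ∑ i, dirDeriv (spaceVec i) (dirDeriv (spaceVec i) w) z

lemma contDiff_waveOp {m n : ℕ∞ω} {w : Rd d × ℝ → G} (hw : ContDiff ℝ n w) (h : m + 1 + 1 ≤ n) :
    ContDiff ℝ m (waveOp w) :=
  have hdd (v) : ContDiff ℝ m (dirDeriv v (dirDeriv v w)) :=
    contDiff_dirDeriv (contDiff_dirDeriv hw h v) le_rfl v
  (hdd timeVec).sub (ContDiff.sum fun i _ => hdd (spaceVec i))

end WaveOperator

section ConeWeight

variable {E : Type*} [NormedAddCommGroup E]

/-- A smooth weight which, for `c = ±1`, is supported in the light cone `‖x - x₀‖ ≤ |ρ - c t|` with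
vertex `(x₀, c ρ)`. -/
def coneWeight (x₀ : E) (ρ c : ℝ) (z : E × ℝ) : ℝ :=
  expNegInvGlue ((ρ - c * z.2) ^ 2 - ‖z.1 - x₀‖ ^ 2)

variable {x₀ : E} {ρ c : ℝ}

lemma coneWeight_nonneg (z : E × ℝ) : 0 ≤ coneWeight x₀ ρ c z := expNegInvGlue.nonneg _

lemma coneWeight_eq_zero {z : E × ℝ} (hz : |ρ - c * z.2| ≤ ‖z.1 - x₀‖) :
    coneWeight x₀ ρ c z = 0 := by
  refine expNegInvGlue.zero_of_nonpos (sub_nonpos.2 ?_)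
  rw [← sq_abs]
  gcongr

lemma coneWeight_axis_pos {t : ℝ} (ht : c * t < ρ) : 0 < coneWeight x₀ ρ c (x₀, t) :=
  expNegInvGlue.pos_of_pos <| by
    simpa using pow_pos (sub_pos.2 ht) 2

variable (x₀ ρ c) in
lemma spatiallyCompact_coneWeight : SpatiallyCompact (coneWeight x₀ ρ c) := fun T => by
  refine ⟨|ρ| + |c| * T + ‖x₀‖, fun x t ht hx => coneWeight_eq_zero ?_⟩
  have hrad : |ρ - c * t| ≤ |ρ| + |c| * T := by
    refine (abs_sub _ _).trans ?_
    rw [abs_mul]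
    gcongr
  linarith [norm_sub_norm_le x x₀]

variable [InnerProductSpace ℝ E]

lemma contDiff_coneWeight {n : ℕ∞} : ContDiff ℝ n (coneWeight x₀ ρ c) :=
  expNegInvGlue.contDiff.comp
    (((contDiff_const.sub (contDiff_const.mul contDiff_snd)).pow 2).sub
      ((contDiff_norm_sq ℝ).comp (contDiff_fst.sub contDiff_const)))

lemma dirDeriv_coneWeight (v z : E × ℝ) :
    dirDeriv v (coneWeight x₀ ρ c) z =
      deriv expNegInvGlue ((ρ - c * z.2) ^ 2 - ‖z.1 - x₀‖ ^ 2) *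
        (-(2 * c * (ρ - c * z.2) * v.2) - 2 * inner ℝ (z.1 - x₀) v.1) := by
  have hspace : HasFDerivAt (fun z : E × ℝ => z.1 - x₀) (ContinuousLinearMap.fst ℝ E ℝ) z :=
    hasFDerivAt_fst.sub_const x₀
  have htime : HasFDerivAt (fun z : E × ℝ => ρ - c * z.2)
      (-(c • ContinuousLinearMap.snd ℝ E ℝ)) z :=
    (hasFDerivAt_snd.const_mul c).const_sub ρ
  have hglue := (expNegInvGlue.contDiff.differentiable (n := 1) one_ne_zero
    ((ρ - c * z.2) ^ 2 - ‖z.1 - x₀‖ ^ 2)).hasDerivAt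
  have h : HasFDerivAt (coneWeight x₀ ρ c) _ z :=
    hglue.comp_hasFDerivAt z ((htime.pow 2).sub hspace.norm_sq)
  rw [dirDeriv, h.fderiv]
  simp only [smul_apply, sub_apply, neg_apply, smul_eq_mul, nsmul_eq_mul,
    ContinuousLinearMap.comp_apply, ContinuousLinearMap.coe_fst', ContinuousLinearMap.coe_snd',
    innerSL_apply_apply]
  push_cast
  ring

end ConeWeight

section Energy

lemma two_mul_sum_mul_le {ι : Type*} (s : Finset ι) (a : ℝ) {r : ℝ} (b y : ι → ℝ) (hr : 0 < r)
    (hy : ∑ i ∈ s, y i ^ 2 ≤ r ^ 2) :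
    2 * a * ∑ i ∈ s, b i * y i ≤ r * (a ^ 2 + ∑ i ∈ s, b i ^ 2) := by
  have hsq : 0 ≤ ∑ i ∈ s, (r * b i - a * y i) ^ 2 := Finset.sum_nonneg fun _ _ => sq_nonneg _
  have hexpand : ∑ i ∈ s, (r * b i - a * y i) ^ 2 =
      r ^ 2 * ∑ i ∈ s, b i ^ 2 - 2 * r * a * ∑ i ∈ s, b i * y i + a ^ 2 * ∑ i ∈ s, y i ^ 2 := by
    simp only [Finset.mul_sum, ← Finset.sum_sub_distrib, ← Finset.sum_add_distrib]
    exact Finset.sum_congr rfl fun i _ => by ring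
  refine le_of_mul_le_mul_left ?_ hr
  nlinarith [mul_le_mul_of_nonneg_left hy (sq_nonneg a)]

variable {d : ℕ} {w : Rd d × ℝ → ℝ}

/-- The energy density `(∂_t w)² + |∇w|²`. -/
def energyDensity (w : Rd d × ℝ → ℝ) (z : Rd d × ℝ) : ℝ :=
  dirDeriv timeVec w z ^ 2 + ∑ i, dirDeriv (spaceVec i) w z ^ 2

/-- The `i`-th component `2 ∂_t w ∂_i w` of the energy flux. -/
def energyFlux (w : Rd d × ℝ → ℝ) (i : Fin d) (z : Rd d × ℝ) : ℝ :=
  2 * (dirDeriv timeVec w z * dirDeriv (spaceVec i) w z)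

lemma energyDensity_nonneg (z : Rd d × ℝ) : 0 ≤ energyDensity w z :=
  add_nonneg (sq_nonneg _) (Finset.sum_nonneg fun _ _ => sq_nonneg _)

lemma contDiff_energyDensity (hw : ContDiff ℝ 2 w) : ContDiff ℝ 1 (energyDensity w) :=
  ((contDiff_dirDeriv hw (by norm_num) _).pow 2).add
    (ContDiff.sum fun i _ => (contDiff_dirDeriv hw (by norm_num) _).pow 2)

lemma contDiff_energyFlux (hw : ContDiff ℝ 2 w) (i : Fin d) : ContDiff ℝ 1 (energyFlux w i) :=
  contDiff_const.mul
    ((contDiff_dirDeriv hw (by norm_num) _).mul (contDiff_dirDeriv hw (by norm_num) _))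

lemma dirDeriv_energyDensity (hw : ContDiff ℝ 2 w) (z : Rd d × ℝ) :
    dirDeriv timeVec (energyDensity w) z =
      ∑ i, dirDeriv (spaceVec i) (energyFlux w i) z + 2 * dirDeriv timeVec w z * waveOp w z := by
  have hd (v z) : DifferentiableAt ℝ (dirDeriv v w) z :=
    (contDiff_dirDeriv hw (m := 1) (by norm_num) v).differentiable one_ne_zero z
  have hdensity : dirDeriv timeVec (energyDensity w) z =
      2 * dirDeriv timeVec w z * dirDeriv timeVec (dirDeriv timeVec w) z +
        ∑ i, 2 * dirDeriv (spaceVec i) w z * dirDeriv timeVec (dirDeriv (spaceVec i) w) z := by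
    unfold energyDensity
    rw [dirDeriv_add _ ((hd _ _).fun_pow 2)
      (DifferentiableAt.fun_sum fun i _ => (hd (spaceVec i) z).fun_pow 2),
      dirDeriv_sum _ _ fun i _ => (hd (spaceVec i) z).fun_pow 2]
    simp only [dirDeriv_sq _ (hd _ _)]
  have hflux (i) : dirDeriv (spaceVec i) (energyFlux w i) z =
      2 * dirDeriv timeVec w z * dirDeriv (spaceVec i) (dirDeriv (spaceVec i) w) z +
        2 * dirDeriv (spaceVec i) w z * dirDeriv timeVec (dirDeriv (spaceVec i) w) z := by
    unfold energyFlux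
    rw [dirDeriv_const_mul _ ((hd _ _).fun_mul (hd _ _)), dirDeriv_mul _ (hd _ _) (hd _ _),
      dirDeriv_comm hw (spaceVec i) timeVec]
    ring
  simp only [hdensity, hflux, waveOp, Finset.sum_add_distrib, ← Finset.mul_sum]
  ring

/-- Inside the cone the weight decreases at unit speed away from the axis, so that it loses at
least as much energy in time as flows in across its level sets. -/
lemma coneWeight_energy_balance_nonpos {x₀ : Rd d} {ρ c : ℝ} (hc : c ^ 2 = 1) {z : Rd d × ℝ}
    (hz : c * z.2 < ρ) :
    c * (dirDeriv timeVec (coneWeight x₀ ρ c) z * energyDensity w z -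
      ∑ i, dirDeriv (spaceVec i) (coneWeight x₀ ρ c) z * energyFlux w i z) ≤ 0 := by
  rcases lt_or_ge ((ρ - c * z.2) ^ 2 - ‖z.1 - x₀‖ ^ 2) 0 with hout | hin
  · have hglue : expNegInvGlue =ᶠ[𝓝 ((ρ - c * z.2) ^ 2 - ‖z.1 - x₀‖ ^ 2)] fun _ => 0 := by
      filter_upwards [Iio_mem_nhds hout] with y hy using expNegInvGlue.zero_of_nonpos (le_of_lt hy)
    simp [dirDeriv_coneWeight, hglue.deriv_eq]
  · have hcauchy := two_mul_sum_mul_le Finset.univ (c * dirDeriv timeVec w z)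
      (fun i => dirDeriv (spaceVec i) w z) (fun i => (z.1 - x₀) i) (sub_pos.2 hz)
      (by rw [← EuclideanSpace.real_norm_sq_eq]; linarith)
    rw [mul_pow, hc, one_mul] at hcauchy
    have hslope : 0 ≤ deriv expNegInvGlue ((ρ - c * z.2) ^ 2 - ‖z.1 - x₀‖ ^ 2) :=
      expNegInvGlue.monotone.deriv_nonneg
    have hsum : ∑ i, dirDeriv (spaceVec i) (coneWeight x₀ ρ c) z * energyFlux w i z =
        -(4 * deriv expNegInvGlue ((ρ - c * z.2) ^ 2 - ‖z.1 - x₀‖ ^ 2) * dirDeriv timeVec w z) *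
          ∑ i, dirDeriv (spaceVec i) w z * (z.1 - x₀) i := by
      rw [Finset.mul_sum]
      refine Finset.sum_congr rfl fun i _ => ?_
      simp only [dirDeriv_coneWeight, energyFlux, spaceVec, EuclideanSpace.inner_single_right,
        conj_trivial]
      ring
    rw [hsum, dirDeriv_coneWeight, energyDensity]
    simp only [timeVec, inner_zero_right] at hcauchy ⊢
    linear_combination 2 * mul_le_mul_of_nonneg_left hcauchy hslope -
      2 * deriv expNegInvGlue ((ρ - c * z.2) ^ 2 - ‖z.1 - x₀‖ ^ 2) * (ρ - c * z.2) *
        (dirDeriv (0, 1) w z ^ 2 + ∑ i, dirDeriv (spaceVec i) w z ^ 2) * hc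

/-- The energy in the light cone, weighted by `coneWeight`. -/
def coneEnergy (w : Rd d × ℝ → ℝ) (x₀ : Rd d) (ρ c t : ℝ) : ℝ :=
  ∫ x, coneWeight x₀ ρ c (x, t) • energyDensity w (x, t)

lemma antitoneOn_coneEnergy (hw : ContDiff ℝ 2 w) (hwave : waveOp w = 0) {x₀ : Rd d} {ρ c : ℝ}
    (hc : c ^ 2 = 1) : AntitoneOn (fun τ => coneEnergy w x₀ ρ c (c * τ)) (Iic ρ) := by
  have hderiv (τ : ℝ) := (hasDerivAt_integral_slice_of_conservation (μ := volume)
    (v := fun i => EuclideanSpace.single i 1) (contDiff_energyDensity hw) (contDiff_energyFlux hw)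
    (fun z => (dirDeriv_energyDensity hw z).trans (by simp [hwave, spaceVec]))
    (contDiff_coneWeight (n := 1)) (spatiallyCompact_coneWeight x₀ ρ c)
    (c * τ)).comp_of_eq τ (by simpa using (hasDerivAt_id τ).const_mul c) rfl
  refine antitoneOn_of_hasDerivWithinAt_nonpos (convex_Iic _)
    (fun τ _ => (hderiv τ).continuousAt.continuousWithinAt)
    (fun τ _ => (hderiv τ).hasDerivWithinAt) fun τ hτ => ?_
  rw [interior_Iic] at hτ
  rw [mul_comm, ← integral_const_mul]
  refine integral_nonpos fun x => coneWeight_energy_balance_nonpos hc ?_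
  simpa [← mul_assoc, ← sq, hc] using hτ

lemma energyDensity_eq_zero_of_coneEnergy_nonpos (hw : ContDiff ℝ 2 w) {x₀ : Rd d} {ρ c t : ℝ}
    (ht : c * t < ρ) (h : coneEnergy w x₀ ρ c t ≤ 0) : energyDensity w (x₀, t) = 0 := by
  by_contra hne
  have hcont : Continuous fun x => coneWeight x₀ ρ c (x, t) • energyDensity w (x, t) :=
    ((contDiff_coneWeight (n := 0)).continuous.smul (contDiff_energyDensity hw).continuous).comp
      (by fun_prop)
  have hsupp : SpatiallyCompact fun z => coneWeight x₀ ρ c z • energyDensity w z :=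
    (spatiallyCompact_coneWeight x₀ ρ c).mono fun z hz => by simp [hz]
  exact h.not_gt <| hcont.integral_pos_of_hasCompactSupport_nonneg_nonzero
    (hsupp.hasCompactSupport_slice t)
    (fun x => smul_nonneg (coneWeight_nonneg _) (energyDensity_nonneg _))
    (smul_ne_zero (coneWeight_axis_pos ht).ne' hne)

lemma dirDeriv_timeVec_eq_zero_of_cone (hw : ContDiff ℝ 2 w) (hwave : waveOp w = 0)
    (hw0 : ∀ x, w (x, 0) = 0) {x₀ : Rd d} {ρ c : ℝ} (hc : c ^ 2 = 1)
    (hw1 : ∀ x, ‖x - x₀‖ < ρ → dirDeriv timeVec w (x, 0) = 0) {t : ℝ} (ht : 0 ≤ c * t)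
    (htρ : c * t < ρ) : dirDeriv timeVec w (x₀, t) = 0 := by
  have hinit : coneEnergy w x₀ ρ c 0 = 0 := by
    refine integral_eq_zero_of_ae (Eventually.of_forall fun x => ?_)
    have hspace (i) : dirDeriv (spaceVec i) w (x, 0) = 0 := by
      rw [spaceVec, ← fderiv_slice (hw.differentiable two_ne_zero)]
      simp [hw0]
    rcases lt_or_ge ‖x - x₀‖ ρ with hx | hx
    · simp [energyDensity, hw1 x hx, hspace]
    · have hρ : 0 ≤ ρ := by linarith
      simp [coneWeight_eq_zero (x₀ := x₀) (ρ := ρ) (c := c) (z := (x, 0))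
        (by simpa [abs_of_nonneg hρ] using hx)]
  have hmono := antitoneOn_coneEnergy hw hwave (x₀ := x₀) (ρ := ρ) hc (mem_Iic.2 (ht.trans htρ.le))
    (mem_Iic.2 htρ.le) ht
  simp only [← mul_assoc, ← sq, hc, one_mul, mul_zero, hinit] at hmono
  have henergy := energyDensity_eq_zero_of_coneEnergy_nonpos hw htρ hmono
  rw [energyDensity, add_eq_zero_iff_of_nonneg (sq_nonneg _)
    (Finset.sum_nonneg fun _ _ => sq_nonneg _)] at henergy
  exact pow_eq_zero_iff two_ne_zero |>.1 henergy.1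

lemma eq_zero_of_add_abs_lt_norm_sub (hw : ContDiff ℝ 2 w) (hwave : waveOp w = 0)
    (hw0 : ∀ x, w (x, 0) = 0) {x₀ : Rd d} {R : ℝ}
    (hw1 : ∀ x, R < ‖x - x₀‖ → dirDeriv timeVec w (x, 0) = 0) {x : Rd d} {t : ℝ}
    (hx : R + |t| < ‖x - x₀‖) : w (x, t) = 0 := by
  have hcone (y) (hy : ‖y - x‖ < ‖x - x₀‖ - R) : dirDeriv timeVec w (y, 0) = 0 := by
    refine hw1 y ?_
    linarith [norm_sub_le_norm_sub_add_norm_sub x y x₀, norm_sub_rev x y]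
  have hderiv (s) (hs : |s| ≤ |t|) : dirDeriv timeVec w (x, s) = 0 := by
    rcases abs_cases s with ⟨habs, hsign⟩ | ⟨habs, hsign⟩
    · exact dirDeriv_timeVec_eq_zero_of_cone hw hwave hw0 (c := 1) (by norm_num) hcone
        (by linarith) (by linarith)
    · exact dirDeriv_timeVec_eq_zero_of_cone hw hwave hw0 (c := -1) (by norm_num) hcone
        (by linarith) (by linarith)
  have hmv := (convex_uIcc (0 : ℝ) t).norm_image_sub_le_of_norm_hasDerivWithin_le (C := 0)
    (fun s _ => (hasDerivAt_time (hw.differentiable two_ne_zero) x s).hasDerivWithinAt)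
    (fun s hs => by rw [hderiv s (by simpa using abs_sub_left_of_mem_uIcc hs), norm_zero])
    left_mem_uIcc right_mem_uIcc
  simpa [hw0] using hmv

end Energy

/-! ### Solutions of the wave equation by the Fourier transform -/

open scoped FourierTransform Real SchwartzMap

section ConeFourier

set_option maxSynthPendingDepth 3

variable {E : Type*} [NormedAddCommGroup E]

/-- The map `(ξ, σ) ↦ (ξ, σ ‖ξ‖)`, which parametrizes the solid light cone `|τ| ≤ ‖ξ‖` by
`σ ∈ [-1, 1]`. -/
def coneParam (p : E × ℝ) : E × ℝ := (p.1, p.2 * ‖p.1‖)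

lemma continuous_coneParam : Continuous (coneParam : E × ℝ → E × ℝ) := by
  unfold coneParam
  fun_prop

variable [InnerProductSpace ℝ E]

variable (E) in
/-- Minus the duality pairing of frequencies with points of space-time, so that the resulting
Fourier integrals have the kernel `exp (2πi (⟪ξ, x⟫ + τ t))`. -/
def phaseForm : E × ℝ →L[ℝ] E × ℝ →L[ℝ] ℝ :=
  let spacePairing : E →L[ℝ] E →L[ℝ] ℝ := innerSL ℝ;
  -(spacePairing.bilinearComp (.fst ℝ E ℝ) (.fst ℝ E ℝ) +
    (ContinuousLinearMap.mul ℝ ℝ).bilinearComp (.snd ℝ E ℝ) (.snd ℝ E ℝ))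

lemma phaseForm_apply (v z : E × ℝ) : phaseForm E v z = -(inner ℝ v.1 z.1 + v.2 * z.2) := rfl

/-- The symbol of the directional derivative `∂_w`. -/
def symbol (w v : E × ℝ) : ℂ := -(2 * π * Complex.I) * phaseForm E v w

lemma continuous_symbol (w : E × ℝ) : Continuous (symbol w) := by
  unfold symbol
  fun_prop

lemma norm_symbol_le (w v : E × ℝ) : ‖symbol w v‖ ≤ 2 * π * ‖phaseForm E‖ * ‖w‖ * ‖v‖ := by
  have hpairing := (phaseForm E).le_opNorm₂ v w
  simp only [symbol, norm_mul, norm_neg, Complex.norm_I, Complex.norm_real, Complex.norm_two,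
    Real.norm_of_nonneg Real.pi_pos.le]
  nlinarith [Real.pi_pos]

lemma symbol_timeVec (v : E × ℝ) : symbol timeVec v = 2 * π * Complex.I * v.2 := by
  simp [symbol, timeVec, phaseForm_apply]

variable [FiniteDimensional ℝ E] [MeasurableSpace E] [BorelSpace E]

variable (E) in
/-- The image of the measure `dξ dσ` under `coneParam`, carried by the solid light cone in
frequency space. -/
def coneMeasure : Measure (E × ℝ) :=
  Measure.map coneParam (volume.prod (volume.restrict (Icc (-1) 1)))

/-- All moments of `h` with respect to `coneMeasure` are finite. -/
def HasMoments (h : E × ℝ → ℂ) : Prop :=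
  AEStronglyMeasurable h (coneMeasure E) ∧
    ∀ n : ℕ, Integrable (fun v => ‖v‖ ^ n * ‖h v‖) (coneMeasure E)

/-- The Fourier transform of `h • coneMeasure E`. -/
def coneFourier (h : E × ℝ → ℂ) : E × ℝ → ℂ :=
  VectorFourier.fourierIntegral 𝐞 (coneMeasure E) (phaseForm E).toLinearMap₁₂ h

variable {h : E × ℝ → ℂ}

lemma HasMoments.integrable (hh : HasMoments h) : Integrable h (coneMeasure E) :=
  (integrable_norm_iff hh.1).1 (by simpa using hh.2 0)

lemma HasMoments.mul_of_norm_le_pow (hh : HasMoments h) {m : E × ℝ → ℂ} (hm : Continuous m)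
    {C : ℝ} {k : ℕ} (hC : ∀ v, ‖m v‖ ≤ C * ‖v‖ ^ k) : HasMoments fun v => m v * h v := by
  have hmeas := hm.aestronglyMeasurable.mul hh.1
  refine ⟨hmeas, fun n => ((hh.2 (n + k)).const_mul C).mono'
    ((continuous_norm.pow n).aestronglyMeasurable.mul hmeas.norm)
    (Eventually.of_forall fun v => ?_)⟩
  calc ‖‖v‖ ^ n * ‖m v * h v‖‖ = ‖v‖ ^ n * (‖m v‖ * ‖h v‖) := by simp
    _ ≤ ‖v‖ ^ n * (C * ‖v‖ ^ k * ‖h v‖) := by gcongr; exact hC v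
    _ = C * (‖v‖ ^ (n + k) * ‖h v‖) := by ring

lemma HasMoments.symbol_mul (hh : HasMoments h) (w : E × ℝ) :
    HasMoments fun v => symbol w v * h v :=
  hh.mul_of_norm_le_pow (k := 1) (continuous_symbol w) fun v => by simpa using norm_symbol_le w v

lemma hasMoments_of_schwartz (φ : 𝓢(E, ℂ)) : HasMoments fun v : E × ℝ => φ v.1 := by
  have hφ : Continuous fun v : E × ℝ => φ v.1 := φ.continuous.comp continuous_fst
  refine ⟨hφ.aestronglyMeasurable, fun n => ?_⟩
  have hmoment : Continuous fun v : E × ℝ => ‖v‖ ^ n * ‖φ v.1‖ := by fun_prop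
  rw [coneMeasure, integrable_map_measure hmoment.aestronglyMeasurable
    continuous_coneParam.measurable.aemeasurable]
  have hint : Integrable (fun p : E × ℝ => ‖p.1‖ ^ n * ‖φ p.1‖)
      (volume.prod (volume.restrict (Icc (-1) 1))) :=
    (φ.integrable_pow_mul volume n).comp_fst _
  refine hint.mono' (hmoment.comp continuous_coneParam).aestronglyMeasurable ?_
  filter_upwards [Measure.quasiMeasurePreserving_snd.ae (ae_restrict_mem measurableSet_Icc)]
    with p hp
  have hσ : ‖p.2 * ‖p.1‖‖ ≤ ‖p.1‖ := by
    rw [norm_mul, norm_norm]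
    exact mul_le_of_le_one_left (norm_nonneg _) (abs_le.2 hp)
  have hparam : ‖coneParam p‖ = ‖p.1‖ := max_eq_left hσ
  simp only [Function.comp_apply, hparam, norm_mul, norm_pow, norm_norm]
  exact le_rfl

lemma integrable_fourierChar_smul (hh : Integrable h (coneMeasure E)) (z : E × ℝ) :
    Integrable (fun v => 𝐞 (-(phaseForm E).toLinearMap₁₂ v z) • h v) (coneMeasure E) :=
  (VectorFourier.fourierIntegral_convergent_iff Real.continuous_fourierChar
    (phaseForm E).continuous₂ z).2 hh

lemma coneFourier_add {h' : E × ℝ → ℂ} (hh : Integrable h (coneMeasure E))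
    (hh' : Integrable h' (coneMeasure E)) (z : E × ℝ) :
    coneFourier (fun v => h v + h' v) z = coneFourier h z + coneFourier h' z := by
  simp only [coneFourier, VectorFourier.fourierIntegral, smul_add]
  exact integral_add (integrable_fourierChar_smul hh z) (integrable_fourierChar_smul hh' z)

lemma coneFourier_const_mul (c : ℂ) (h : E × ℝ → ℂ) (z : E × ℝ) :
    coneFourier (fun v => c * h v) z = c * coneFourier h z :=
  congrFun (VectorFourier.fourierIntegral_const_smul 𝐞 _ _ h c) z

lemma contDiff_coneFourier (hh : HasMoments h) : ContDiff ℝ ∞ (coneFourier h) :=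
  VectorFourier.contDiff_fourierIntegral (phaseForm E) fun n _ => hh.2 n

lemma dirDeriv_coneFourier (hh : HasMoments h) (w : E × ℝ) :
    dirDeriv w (coneFourier h) = coneFourier fun v => symbol w v * h v := by
  funext z
  have hfirst : Integrable (fun v => ‖v‖ * ‖h v‖) (coneMeasure E) := by simpa using hh.2 1
  have hderiv : Integrable (VectorFourier.fourierSMulRight (phaseForm E) h) (coneMeasure E) :=
    (hfirst.const_mul (2 * π * ‖phaseForm E‖)).mono' hh.1.fourierSMulRight
      (Eventually.of_forall fun v => by
        simpa [mul_assoc] using VectorFourier.norm_fourierSMulRight_le (phaseForm E) h v)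
  rw [dirDeriv, coneFourier, VectorFourier.fderiv_fourierIntegral _ hh.integrable hfirst,
    Real.fourierIntegral_continuousLinearMap_apply' hderiv]
  congr 1
  funext v
  simp [symbol, mul_assoc]

lemma coneFourier_apply (hh : Integrable h (coneMeasure E)) (z : E × ℝ) :
    coneFourier h z = ∫ ξ, ∫ σ in Icc (-1 : ℝ) 1,
      Complex.exp ((2 * π * inner ℝ ξ z.1 : ℝ) * Complex.I) *
        Complex.exp ((2 * π * (σ * ‖ξ‖ * z.2) : ℝ) * Complex.I) * h (ξ, σ * ‖ξ‖) := by
  have hkernel (v : E × ℝ) : 𝐞 (-(phaseForm E).toLinearMap₁₂ v z) • h v =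
      Complex.exp ((2 * π * inner ℝ v.1 z.1 : ℝ) * Complex.I) *
        Complex.exp ((2 * π * (v.2 * z.2) : ℝ) * Complex.I) * h v := by
    have hphase : (phaseForm E).toLinearMap₁₂ v z = -(inner ℝ v.1 z.1 + v.2 * z.2) := rfl
    rw [← Complex.exp_add, Circle.smul_def, Real.fourierChar_apply, smul_eq_mul, hphase]
    push_cast
    ring_nf
  have hint := integrable_fourierChar_smul hh z
  have hcomp := hint.comp_aemeasurable continuous_coneParam.measurable.aemeasurable
  rw [coneFourier, VectorFourier.fourierIntegral]
  rw [coneMeasure, integral_map continuous_coneParam.measurable.aemeasurable hint.1]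
  simp only [Function.comp_def, hkernel] at hcomp ⊢
  exact integral_prod _ hcomp

/-- The integrand is the `σ`-derivative of `-2πia (1 - σ²) exp (2πi σat)`. -/
lemma integral_exp_mul_darboux_symbol (a t : ℝ) :
    ∫ σ in Icc (-1 : ℝ) 1, Complex.exp ((2 * π * (σ * a * t) : ℝ) * Complex.I) *
      (4 * π * Complex.I * σ * a + 4 * π ^ 2 * t * a ^ 2 * (1 - σ ^ 2)) = 0 := by
  rw [integral_Icc_eq_integral_Ioc, ← intervalIntegral.integral_of_le (by norm_num)]
  have hderiv (σ : ℝ) : HasDerivAt (fun σ : ℝ => -(2 * π) * Complex.I * a * (1 - (σ : ℂ) ^ 2) *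
      Complex.exp ((2 * π * (σ * a * t) : ℝ) * Complex.I))
      (Complex.exp ((2 * π * (σ * a * t) : ℝ) * Complex.I) *
        (4 * π * Complex.I * σ * a + 4 * π ^ 2 * t * a ^ 2 * (1 - σ ^ 2))) σ := by
    have hσ : HasDerivAt (fun σ : ℝ => (σ : ℂ)) 1 σ := Complex.ofRealCLM.hasDerivAt
    have hpoly : HasDerivAt (fun σ : ℝ => -(2 * π) * Complex.I * a * (1 - (σ : ℂ) ^ 2))
        (4 * π * Complex.I * a * σ) σ :=
      (((hσ.pow 2).const_sub 1).const_mul _).congr_deriv (by push_cast; ring)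
    have hphase : HasDerivAt (fun σ : ℝ => ((2 * π * (σ * a * t) : ℝ) : ℂ) * Complex.I)
        (2 * π * a * t * Complex.I) σ := by
      simpa [mul_assoc] using (hσ.mul_const (a * t * Complex.I)).const_mul (2 * π : ℂ)
    refine (hpoly.mul hphase.cexp).congr_deriv ?_
    linear_combination (-(4 * π ^ 2 * t * a ^ 2 * (1 - (σ : ℂ) ^ 2)) *
      Complex.exp ((2 * π * (σ * a * t) : ℝ) * Complex.I)) * Complex.I_sq
  rw [intervalIntegral.integral_eq_sub_of_hasDerivAt (fun σ _ => hderiv σ)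
    (Continuous.intervalIntegrable (by fun_prop) _ _)]
  simp

lemma coneFourier_zero_time (φ : 𝓢(E, ℂ)) (x : E) :
    coneFourier (fun v => (𝓕 φ) v.1) (x, 0) = 2 * φ x := by
  have hinv : 𝓕⁻ (𝓕 φ) x = φ x := by simp
  rw [coneFourier_apply (hasMoments_of_schwartz (𝓕 φ)).integrable, ← hinv,
    SchwartzMap.fourierInv_coe, Real.fourierInv_eq', ← integral_const_mul]
  refine integral_congr_ae (Eventually.of_forall fun ξ => ?_)
  norm_num

end ConeFourier

section CauchyProblem

variable {d : ℕ}

lemma symbol_timeVec_sq_sub_sum (v : Rd d × ℝ) :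
    symbol timeVec v ^ 2 - ∑ i, symbol (spaceVec i) v ^ 2 =
      4 * π ^ 2 * (‖v.1‖ ^ 2 - v.2 ^ 2 : ℝ) := by
  have hspace (i : Fin d) : symbol (spaceVec i) v = 2 * π * Complex.I * v.1 i := by
    simp [symbol, spaceVec, phaseForm_apply, EuclideanSpace.inner_single_right]
  simp only [hspace, symbol_timeVec, mul_pow, ← Finset.mul_sum, EuclideanSpace.real_norm_sq_eq]
  push_cast
  linear_combination (4 * π ^ 2 * v.2 ^ 2 - 4 * π ^ 2 * ∑ i, (v.1 i : ℂ) ^ 2) * Complex.I_sq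

lemma waveOp_coneFourier {h : Rd d × ℝ → ℂ} (hh : HasMoments h) :
    waveOp (coneFourier h) =
      coneFourier fun v => 4 * π ^ 2 * (‖v.1‖ ^ 2 - v.2 ^ 2 : ℝ) * h v := by
  have hsnd (w : Rd d × ℝ) : dirDeriv w (dirDeriv w (coneFourier h)) =
      coneFourier fun v => symbol w v * (symbol w v * h v) := by
    rw [dirDeriv_coneFourier hh, dirDeriv_coneFourier (hh.symbol_mul w)]
  funext z
  have hint (w : Rd d × ℝ) :=
    integrable_fourierChar_smul ((hh.symbol_mul w).symbol_mul w).integrable z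
  simp only [waveOp, hsnd]
  unfold coneFourier VectorFourier.fourierIntegral
  rw [← integral_finsetSum _ fun i _ => hint (spaceVec i),
    ← integral_sub (hint timeVec) (integrable_finsetSum _ fun i _ => hint (spaceVec i))]
  refine integral_congr_ae (Eventually.of_forall fun v => ?_)
  simp only [← symbol_timeVec_sq_sub_sum, ← Finset.smul_sum, ← smul_sub, ← mul_assoc, ← sq,
    ← Finset.sum_mul, ← sub_mul]

lemma HasMoments.waveSymbol_mul {h : Rd d × ℝ → ℂ} (hh : HasMoments h) :
    HasMoments fun v => 4 * π ^ 2 * (‖v.1‖ ^ 2 - v.2 ^ 2 : ℝ) * h v := by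
  refine hh.mul_of_norm_le_pow (k := 2) (C := 4 * π ^ 2) (by fun_prop) fun v => ?_
  have hspace : ‖v.1‖ ^ 2 ≤ ‖v‖ ^ 2 := by gcongr; exact norm_fst_le v
  have htime : v.2 ^ 2 ≤ ‖v‖ ^ 2 := sq_le_sq.2 (by simpa using norm_snd_le v)
  have hdiff : |‖v.1‖ ^ 2 - v.2 ^ 2| ≤ ‖v‖ ^ 2 :=
    abs_sub_le_iff.2 ⟨by linarith [sq_nonneg v.2], by linarith [sq_nonneg ‖v.1‖]⟩
  have hconst : ‖(4 * π ^ 2 : ℂ)‖ = 4 * π ^ 2 := by simp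
  rw [norm_mul, hconst, Complex.norm_real, Real.norm_eq_abs]
  gcongr

lemma euler_poisson_darboux_coneFourier (φ : 𝓢(Rd d, ℂ)) (z : Rd d × ℝ) :
    2 * dirDeriv timeVec (coneFourier fun v => φ v.1) z +
      z.2 * waveOp (coneFourier fun v => φ v.1) z = 0 := by
  have hφ := hasMoments_of_schwartz φ
  have htime := (hφ.symbol_mul timeVec).integrable.const_mul 2
  have hwave := hφ.waveSymbol_mul.integrable.const_mul (z.2 : ℂ)
  rw [dirDeriv_coneFourier hφ, waveOp_coneFourier hφ, ← coneFourier_const_mul,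
    ← coneFourier_const_mul, ← coneFourier_add htime hwave, coneFourier_apply (htime.fun_add hwave)]
  refine (integral_congr_ae (Eventually.of_forall fun ξ => ?_)).trans (integral_zero _ _)
  have hdarboux := integral_exp_mul_darboux_symbol ‖ξ‖ z.2
  rw [← mul_zero (Complex.exp ((2 * π * inner ℝ ξ z.1 : ℝ) * Complex.I) * φ ξ), ← hdarboux,
    ← integral_const_mul]
  refine integral_congr_ae (Eventually.of_forall fun σ => ?_)
  simp only [symbol_timeVec]
  push_cast
  ring

lemma waveOp_time_smul {G : Type*} [NormedAddCommGroup G] [NormedSpace ℝ G] {w : Rd d × ℝ → G}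
    (hw : ContDiff ℝ 2 w) (z : Rd d × ℝ) :
    waveOp (fun z => z.2 • w z) z = (2 : ℝ) • dirDeriv timeVec w z + z.2 • waveOp w z := by
  have hd := hw.differentiable two_ne_zero
  have hdd (v : Rd d × ℝ) := (contDiff_dirDeriv (m := 1) hw (by norm_num) v).differentiable
    one_ne_zero
  have hfst (v : Rd d × ℝ) : dirDeriv v (fun z => z.2 • w z) =
      fun z => z.2 • dirDeriv v w z + v.2 • w z := by
    funext z
    rw [dirDeriv_smul v differentiableAt_snd (hd z), dirDeriv_snd]
  have hsnd (v : Rd d × ℝ) : dirDeriv v (dirDeriv v fun z => z.2 • w z) z =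
      (2 * v.2) • dirDeriv v w z + z.2 • dirDeriv v (dirDeriv v w) z := by
    rw [hfst, dirDeriv_add v (differentiableAt_snd.fun_smul (hdd v z)) ((hd z).fun_const_smul _),
      dirDeriv_smul v differentiableAt_snd (hdd v z),
      dirDeriv_smul v (differentiableAt_const _) (hd z), dirDeriv_snd]
    simp only [dirDeriv, fderiv_fun_const, Pi.zero_apply, zero_apply]
    module
  simp only [waveOp, hsnd, timeVec, spaceVec, mul_one, mul_zero, zero_smul, zero_add,
    ← Finset.smul_sum, smul_sub]
  abel

lemma exists_wave_of_schwartz (φ : 𝓢(Rd d, ℂ)) :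
    ∃ w : Rd d × ℝ → ℂ, ContDiff ℝ ∞ w ∧ waveOp w = 0 ∧ (∀ x, w (x, 0) = 0) ∧
      ∀ x, dirDeriv timeVec w (x, 0) = φ x := by
  set g : 𝓢(Rd d, ℂ) := 𝓕 ((2⁻¹ : ℂ) • φ) with hg
  have hsmooth := contDiff_coneFourier (hasMoments_of_schwartz g)
  refine ⟨fun z => z.2 • coneFourier (fun v => g v.1) z, contDiff_snd.smul hsmooth, ?_,
    fun x => by simp, fun x => ?_⟩
  · funext z
    rw [waveOp_time_smul (hsmooth.of_le (by norm_cast)),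
      Complex.real_smul, Complex.real_smul, Complex.ofReal_ofNat,
      euler_poisson_darboux_coneFourier, Pi.zero_apply]
  · rw [dirDeriv_smul _ differentiableAt_snd (hsmooth.differentiable (by simp) _), dirDeriv_snd,
      hg, coneFourier_zero_time]
    simp [timeVec]

lemma waveOp_clm_comp {G H : Type*} [NormedAddCommGroup G] [NormedSpace ℝ G]
    [NormedAddCommGroup H] [NormedSpace ℝ H] (L : G →L[ℝ] H) {w : Rd d × ℝ → G}
    (hw : ContDiff ℝ 2 w) : waveOp (fun z => L (w z)) = fun z => L (waveOp w z) := by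
  have hsnd (v : Rd d × ℝ) : dirDeriv v (dirDeriv v fun z => L (w z)) =
      fun z => L (dirDeriv v (dirDeriv v w) z) := by
    rw [dirDeriv_clm_comp v L (hw.differentiable two_ne_zero), dirDeriv_clm_comp v L
      ((contDiff_dirDeriv (m := 1) hw (by norm_num) v).differentiable one_ne_zero)]
  funext z
  simp only [waveOp, hsnd, map_sub, map_sum]

lemma waveOp_comp_add_right {G : Type*} [NormedAddCommGroup G] [NormedSpace ℝ G]
    (w : Rd d × ℝ → G) (a : Rd d × ℝ) :
    waveOp (fun z => w (z + a)) = fun z => waveOp w (z + a) := by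
  funext z
  simp only [waveOp, dirDeriv_comp_add_right]

theorem exists_waveOp_eq_zero_of_data {ψ : Rd d → ℝ} (hψ : ContDiff ℝ ∞ ψ) {x₀ : Rd d} {R : ℝ}
    (hR : ∀ x, R < ‖x - x₀‖ → ψ x = 0) (t₀ : ℝ) :
    ∃ W : Rd d × ℝ → ℝ, ContDiff ℝ ∞ W ∧ waveOp W = 0 ∧ (∀ x, W (x, t₀) = 0) ∧
      (∀ x, dirDeriv timeVec W (x, t₀) = ψ x) ∧
      ∀ x t, R + |t - t₀| < ‖x - x₀‖ → W (x, t) = 0 := by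
  have hsupp : HasCompactSupport fun x => (ψ x : ℂ) :=
    HasCompactSupport.intro (isCompact_closedBall x₀ R) fun x hx => by
      simp [hR x (by simpa [dist_eq_norm] using hx)]
  obtain ⟨w, hw, hwave, hw0, hw1⟩ := exists_wave_of_schwartz
    (hsupp.toSchwartzMap (Complex.ofRealCLM.contDiff.comp hψ))
  have hw2 : ContDiff ℝ 2 w := hw.of_le (by norm_cast)
  let V (z : Rd d × ℝ) : ℝ := Complex.reCLM (w z)
  have hV : ContDiff ℝ ∞ V := Complex.reCLM.contDiff.comp hw
  have hVwave : waveOp V = 0 := by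
    rw [waveOp_clm_comp Complex.reCLM hw2, hwave]
    ext
    exact map_zero _
  have hV0 (x) : V (x, 0) = 0 := by simp [V, hw0]
  have hV1 (x) : dirDeriv timeVec V (x, 0) = ψ x := by
    simp only [V, dirDeriv_clm_comp timeVec Complex.reCLM (hw2.differentiable two_ne_zero), hw1]
    exact Complex.ofReal_re (ψ x)
  refine ⟨fun z => V (z + (0, -t₀)), hV.comp (contDiff_id.add contDiff_const), ?_, ?_, ?_, ?_⟩
  · rw [waveOp_comp_add_right, hVwave]
    rfl
  · simp [hV0]
  · simp [dirDeriv_comp_add_right, hV1]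
  · intro x t hx
    exact (congrArg V (by simp [sub_eq_add_neg])).trans <|
      eq_zero_of_add_abs_lt_norm_sub (hV.of_le (by norm_cast)) hVwave hV0
        (fun y hy => (hV1 y).trans (hR y hy)) hx

end CauchyProblem

/-! ### Green's identity -/

section Green

variable {G : Type*} [NormedAddCommGroup G] [NormedSpace ℝ G]

/-- The Wronskian of `W` and `f` in the direction `v`, the component along `v` of the flux in
Green's identity. -/
def wronskian {X : Type*} [NormedAddCommGroup X] [NormedSpace ℝ X] (v : X) (W : X → ℝ) (f : X → G)
    (z : X) : G :=
  W z • dirDeriv v f z - dirDeriv v W z • f z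

section Wronskian

variable {X : Type*} [NormedAddCommGroup X] [NormedSpace ℝ X] {W : X → ℝ} {f : X → G}

lemma contDiff_wronskian (hW : ContDiff ℝ 2 W) (hf : ContDiff ℝ 2 f) (v : X) :
    ContDiff ℝ 1 (wronskian v W f) :=
  ((hW.of_le one_le_two).smul (contDiff_dirDeriv hf (by norm_num) v)).sub
    ((contDiff_dirDeriv hW (by norm_num) v).smul (hf.of_le one_le_two))

lemma dirDeriv_wronskian (hW : ContDiff ℝ 2 W) (hf : ContDiff ℝ 2 f) (v z : X) :
    dirDeriv v (wronskian v W f) z =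
      W z • dirDeriv v (dirDeriv v f) z - dirDeriv v (dirDeriv v W) z • f z := by
  have hdW := hW.differentiable two_ne_zero z
  have hdf := hf.differentiable two_ne_zero z
  have hddW : DifferentiableAt ℝ (dirDeriv v W) z :=
    (contDiff_dirDeriv (m := 1) hW (by norm_num) v).differentiable one_ne_zero z
  have hddf : DifferentiableAt ℝ (dirDeriv v f) z :=
    (contDiff_dirDeriv (m := 1) hf (by norm_num) v).differentiable one_ne_zero z
  unfold wronskian
  rw [dirDeriv_sub v (hdW.fun_smul hddf) (hddW.fun_smul hdf), dirDeriv_smul v hdW hddf,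
    dirDeriv_smul v hddW hdf]
  abel

end Wronskian

lemma SpatiallyCompact.wronskian {E : Type*} [NormedAddCommGroup E] [NormedSpace ℝ E]
    {W : E × ℝ → ℝ} (hWc : SpatiallyCompact W) (v : E × ℝ) (f : E × ℝ → G) :
    SpatiallyCompact (wronskian v W f) :=
  (hWc.mono fun z hz => by simp [hz]).sub ((hWc.dirDeriv v).mono fun z hz => by simp [hz])

variable {d : ℕ} {W : Rd d × ℝ → ℝ}

lemma integral_wronskian (hW : ContDiff ℝ 1 W) (hWc : SpatiallyCompact W) {f : Rd d × ℝ → G}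
    (hf : ContDiff ℝ 1 f) (v : Rd d × ℝ) (t : ℝ) :
    ∫ x, wronskian v W f (x, t) =
      (∫ x, W (x, t) • dirDeriv v f (x, t)) - ∫ x, dirDeriv v W (x, t) • f (x, t) :=
  integral_sub
    ((hWc.mono (F' := fun z => W z • dirDeriv v f z) fun z hz => by simp [hz]).integrable_slice
      (hW.continuous.smul (continuous_dirDeriv hf v)) t)
    (((hWc.dirDeriv v).mono (F' := fun z => dirDeriv v W z • f z) fun z hz => by
      simp [hz]).integrable_slice ((continuous_dirDeriv hW v).smul hf.continuous) t)

lemma integral_smul_slice_eq_sub_wronskian (hW : ContDiff ℝ 1 W) (hWc : SpatiallyCompact W)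
    {ψ : Rd d → ℝ} {t : ℝ} (hW0 : ∀ x, W (x, t) = 0) (hW1 : ∀ x, dirDeriv timeVec W (x, t) = ψ x)
    {f : Rd d × ℝ → G} (hf : ContDiff ℝ 1 f) (s : ℝ) :
    ∫ x, ψ x • f (x, t) =
      (∫ x, dirDeriv timeVec W (x, s) • f (x, s)) - (∫ x, W (x, s) • dirDeriv timeVec f (x, s)) -
        ((∫ x, wronskian timeVec W f (x, t)) - ∫ x, wronskian timeVec W f (x, s)) := by
  rw [integral_wronskian hW hWc hf _ s, integral_wronskian hW hWc hf _ t]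
  simp only [hW0, hW1, zero_smul, integral_zero]
  abel

lemma hasDerivAt_integral_wronskian (hW : ContDiff ℝ 2 W) (hwave : waveOp W = 0)
    (hWc : SpatiallyCompact W) {f : Rd d × ℝ → G} (hf : ContDiff ℝ 2 f) (t : ℝ) :
    HasDerivAt (fun s => ∫ x, wronskian timeVec W f (x, s))
      (∫ x, W (x, t) • waveOp f (x, t)) t := by
  have hdiv (z) : W z • waveOp f z = dirDeriv timeVec (wronskian timeVec W f) z -
      ∑ i, dirDeriv (spaceVec i) (wronskian (spaceVec i) W f) z := by
    have hWz : dirDeriv timeVec (dirDeriv timeVec W) z =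
        ∑ i, dirDeriv (spaceVec i) (dirDeriv (spaceVec i) W) z :=
      sub_eq_zero.1 (congrFun hwave z)
    simp only [dirDeriv_wronskian hW hf, hWz, waveOp, Finset.sum_sub_distrib, Finset.sum_smul,
      smul_sub, Finset.smul_sum]
    abel
  simp only [hdiv]
  exact hasDerivAt_integral_slice_flux (contDiff_wronskian hW hf _) (hWc.wronskian _ f)
    (fun i => contDiff_wronskian hW hf (spaceVec i)) (fun i => hWc.wronskian (spaceVec i) f) t

lemma exists_norm_sub_integral_wronskian_le (hW : ContDiff ℝ 2 W) (hwave : waveOp W = 0)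
    (hWc : SpatiallyCompact W) (a b : ℝ) :
    ∃ C : ℝ, ∃ K : Set (Rd d × ℝ), IsCompact K ∧
      ∀ (f : Rd d × ℝ → G) (M : ℝ), ContDiff ℝ 2 f → (∀ z ∈ K, ‖waveOp f z‖ ≤ M) →
        ‖(∫ x, wronskian timeVec W f (x, b)) - ∫ x, wronskian timeVec W f (x, a)‖ ≤ C * M := by
  obtain ⟨T, hT⟩ := isBounded_iff_forall_norm_le.1 (isCompact_uIcc (a := a) (b := b)).isBounded
  obtain ⟨R, hR⟩ := hWc T
  let B := Metric.closedBall (0 : Rd d) R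
  have hB : IsCompact B := isCompact_closedBall 0 R
  have hK := hB.prod (isCompact_uIcc (a := a) (b := b))
  obtain ⟨N, hN⟩ := hK.exists_bound_of_continuousOn hW.continuous.continuousOn
  refine ⟨N * volume.real B * ‖b - a‖, _, hK, fun f M hf hM => ?_⟩
  have hderiv_le (s) (hs : s ∈ uIcc a b) :
      ‖∫ x, W (x, s) • waveOp f (x, s)‖ ≤ N * M * volume.real B := by
    rw [← setIntegral_eq_integral_of_forall_compl_eq_zero (s := B) fun x hx => by
      rw [hR x s (hT s hs) (by simpa [B] using hx), zero_smul]]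
    refine norm_setIntegral_le_of_norm_le_const hB.measure_lt_top fun x hx => ?_
    rw [norm_smul]
    exact mul_le_mul (hN (x, s) ⟨hx, hs⟩) (hM (x, s) ⟨hx, hs⟩) (norm_nonneg _)
      ((norm_nonneg _).trans (hN (x, s) ⟨hx, hs⟩))
  calc _ ≤ N * M * volume.real B * ‖b - a‖ :=
        (convex_uIcc a b).norm_image_sub_le_of_norm_hasDerivWithin_le
          (fun s _ => (hasDerivAt_integral_wronskian hW hwave hWc hf s).hasDerivWithinAt)
          hderiv_le left_mem_uIcc right_mem_uIcc
    _ = _ := by ring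

end Green

/-! ### Nets of functions -/

section Nets

variable {𝕜 : Type*} [RCLike 𝕜] {d : ℕ}

lemma scale_nonneg (r : ℝ≥0) (ε : Param) : 0 ≤ scale r ε := Real.rpow_nonneg ε.2.1.le _

lemma scale_le_one (r : ℝ≥0) (ε : Param) : scale r ε ≤ 1 :=
  Real.rpow_le_one ε.2.1.le ε.2.2 r.2

lemma tendsto_scale_smul_zero {G : Type*} [NormedAddCommGroup G] [NormedSpace ℝ G]
    {v : Param → G} (r : ℝ≥0) (hv : Tendsto v atBot (𝓝 0)) :
    Tendsto (fun ε => scale r ε • v ε) atBot (𝓝 0) := by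
  refine squeeze_zero_norm (fun ε => ?_) (tendsto_zero_iff_norm_tendsto_zero.1 hv)
  rw [norm_smul, Real.norm_of_nonneg (scale_nonneg r ε)]
  exact mul_le_of_le_one_left (norm_nonneg _) (scale_le_one r ε)

namespace SolidPair

variable {P : SolidPair 𝕜}

section Space

variable {E : Type*} [NormedAddCommGroup E] [NormedSpace ℝ E]

lemma contDiff_of_moderate (f : P.moderate (⊤ : Opens E)) (ε : Param) :
    ContDiff ℝ ∞ ((f : Param → E → 𝕜) ε) := by
  simpa only [Opens.coe_top, contDiffOn_univ] using f.2.1 ε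

lemma netDeriv_top (v : E) (f : P.moderate (⊤ : Opens E)) (ε : Param) :
    (netDeriv v f : Param → E → 𝕜) ε = dirDeriv v ((f : Param → E → 𝕜) ε) := by
  ext z
  simp [netDeriv, dirDeriv]

variable {Ω : Opens E}

lemma cls_eq_cls {f g : P.moderate Ω} : cls f = cls g ↔ f - g ∈ P.negligible Ω :=
  Ideal.Quotient.mk_eq_mk_iff_sub_mem f g

lemma cls_sub (f g : P.moderate Ω) : cls (f - g) = cls f - cls g :=
  map_sub (Ideal.Quotient.mk (P.negligible Ω)) f g

lemma cls_sum {ι : Type*} (s : Finset ι) (f : ι → P.moderate Ω) :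
    cls (∑ i ∈ s, f i) = ∑ i ∈ s, cls (f i) :=
  map_sum (Ideal.Quotient.mk (P.negligible Ω)) f s

end Space

variable (hnull : ∀ v : P.moderate (⊤ : Opens (Rd d)), v ∈ P.negligible ⊤ →
  TendstoDistr ⊤ (v : Param → Rd d → 𝕜) 0)

include hnull

lemma tendsto_integral_of_negligible {v : P.moderate (⊤ : Opens (Rd d))} (hv : v ∈ P.negligible ⊤)
    {ψ : Rd d → ℝ} (hψ : ContDiff ℝ ∞ ψ) (hψc : HasCompactSupport ψ) :
    Tendsto (fun ε => ∫ x, ψ x • (v : Param → Rd d → 𝕜) ε x) atBot (𝓝 0) :=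
  hnull v hv ⟨ψ, hψ, hψc, by simp⟩

-- The constant net `b ε` is negligible; its integral against a normalized bump function is `b ε`.
lemma tendsto_zero_of_mem_absI {b : Param → ℝ} (hb : b ∈ P.absI) : Tendsto b atBot (𝓝 0) := by
  have hnorm (ε) : ‖(b ε : 𝕜)‖ = b ε := by
    rw [RCLike.norm_ofReal, abs_of_nonneg (absA_nonneg (absI_subset hb) ε)]
  have hle (K : Set (Rd d)) l ε : ckSeminorm (⊤ : Opens (Rd d)) K l (fun _ => (b ε : 𝕜)) ≤ b ε :=
    (ckSeminorm_const_le _).trans_eq (hnorm ε)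
  let v : P.moderate (⊤ : Opens (Rd d)) := ⟨fun ε _ => (b ε : 𝕜), fun ε => contDiffOn_const,
    fun K _ _ l => absA_mono (absI_subset hb) (fun _ => ckSeminorm_nonneg) (hle K l)⟩
  have hv : v ∈ P.negligible ⊤ := fun K _ _ l =>
    absI_mono hb (fun _ => ckSeminorm_nonneg) (hle K l)
  let β : ContDiffBump (0 : Rd d) := default
  have hlim := tendsto_integral_of_negligible hnull hv (β.contDiff_normed (μ := volume))
    β.hasCompactSupport_normed
  have hβ (ε) : ∫ x, β.normed volume x • (v : Param → Rd d → 𝕜) ε x = (b ε : 𝕜) := by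
    simp only [v, integral_smul_const, β.integral_normed, one_smul]
  simpa only [hβ, hnorm, norm_zero] using hlim.norm

lemma exists_tendsto_integral_of_regular {r : ℝ≥0} {g : P.moderate (⊤ : Opens (Rd d))}
    {ψ : Rd d → ℝ} (hψ : ContDiff ℝ ∞ ψ) (hψc : HasCompactSupport ψ)
    (hr : ∀ x ∈ tsupport ψ, r ∈ regularExponents (cls g) x) :
    ∃ l, Tendsto (fun ε : Param => ∫ x, ψ x • scale r ε • (g : Param → Rd d → 𝕜) ε x)
      atBot (𝓝 l) := by
  have hg (ε) : LocallyIntegrable fun x => scale r ε • (g : Param → Rd d → 𝕜) ε x :=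
    ((contDiff_of_moderate g ε).continuous.const_smul _).locallyIntegrable
  refine exists_tendsto_integral_of_locally hg hψ hψc fun x hx => ?_
  obtain ⟨f, hf, V, hxV, -, T, hT⟩ := hr x hx
  refine ⟨V, hxV, fun φ => ⟨T φ, ?_⟩⟩
  have hneg := tendsto_integral_of_negligible hnull (cls_eq_cls.1 hf.symm) φ.contDiff
    φ.hasCompactSupport
  have hint (h : P.moderate (⊤ : Opens (Rd d))) (ε) :
      Integrable fun x => φ x • (h : Param → Rd d → 𝕜) ε x :=
    (φ.continuous.smul (contDiff_of_moderate h ε).continuous).integrable_of_hasCompactSupport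
      φ.hasCompactSupport.smul_right
  have hlim := (hT φ).add (tendsto_scale_smul_zero r hneg)
  rw [add_zero] at hlim
  refine hlim.congr fun ε => ?_
  simp only [smul_comm _ (scale r ε), integral_smul, ← smul_add]
  rw [← integral_add (hint f ε) (hint (g - f) ε)]
  simp [smul_sub]

end SolidPair

end Nets

section LightCone

variable {E G : Type*} [NormedAddCommGroup E] [NormedAddCommGroup G] {F : E × ℝ → G} {x₀ : E}
  {R t₀ : ℝ}

lemma spatiallyCompact_of_cone (h : ∀ x t, R + |t - t₀| < ‖x - x₀‖ → F (x, t) = 0) :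
    SpatiallyCompact F := fun T =>
  ⟨R + (T + |t₀|) + ‖x₀‖, fun x t ht hx => h x t <| by
    linarith [norm_sub_norm_le x x₀, abs_sub t t₀]⟩

lemma tsupport_slice_subset_closedBall (h : ∀ x t, R + |t - t₀| < ‖x - x₀‖ → F (x, t) = 0)
    (t : ℝ) : tsupport (fun x => F (x, t)) ⊆ Metric.closedBall x₀ (R + |t - t₀|) :=
  closure_minimal (fun x hx => mem_closedBall_iff_norm.2 (not_lt.1 fun hlt => hx (h x t hlt)))
    Metric.isClosed_closedBall

lemma dirDeriv_eq_zero_of_cone [NormedSpace ℝ E] [NormedSpace ℝ G]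
    (h : ∀ x t, R + |t - t₀| < ‖x - x₀‖ → F (x, t) = 0) (v : E × ℝ) (x : E) (t : ℝ)
    (hx : R + |t - t₀| < ‖x - x₀‖) : dirDeriv v F (x, t) = 0 := by
  have ho : IsOpen {z : E × ℝ | R + |z.2 - t₀| < ‖z.1 - x₀‖} :=
    isOpen_lt (by fun_prop) (by fun_prop)
  have hF : F =ᶠ[𝓝 (x, t)] fun _ => 0 := by
    filter_upwards [ho.mem_nhds hx] with z hz using h z.1 z.2 hz
  simp [dirDeriv, hF.fderiv_eq]

end LightCone

/-! ### Generalized solutions of the wave equation -/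

section Propagation

namespace SolidPair

variable {𝕜 : Type*} [RCLike 𝕜] {P : SolidPair 𝕜} {d : ℕ}
  {f : P.moderate (⊤ : Opens (Rd d × ℝ))} {u₀ u₁ : P.GenFun (⊤ : Opens (Rd d))}

lemma isOpen_setOf_mem_regularExponents (u : P.GenFun (⊤ : Opens (Rd d))) (r : ℝ≥0) :
    IsOpen {x | r ∈ regularExponents u x} :=
  isOpen_iff_mem_nhds.2 fun _ ⟨f, hf, V, hxV, hV⟩ =>
    mem_of_superset (V.isOpen.mem_nhds hxV) fun _ hy => ⟨f, hf, V, hy, hV⟩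

lemma IsWaveSolution.ckSeminorm_waveOp_mem_absI (hu : IsWaveSolution (cls f) u₀ u₁)
    {K : Set (Rd d × ℝ)} (hK : IsCompact K) (l : ℕ) :
    (fun ε => ckSeminorm (⊤ : Opens (Rd d × ℝ)) K l
      (waveOp ((f : Param → Rd d × ℝ → 𝕜) ε))) ∈ P.absI := by
  let n : P.moderate (⊤ : Opens (Rd d × ℝ)) := netDeriv timeVec (netDeriv timeVec f) -
    ∑ i, netDeriv (spaceVec i) (netDeriv (spaceVec i) f)
  have hn : n ∈ P.negligible ⊤ := by
    refine Ideal.Quotient.eq_zero_iff_mem.1 (Eq.trans ?_ hu.wave)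
    exact (cls_sub _ _).trans (congrArg _ (cls_sum _ _))
  have hval (ε) : (n : Param → Rd d × ℝ → 𝕜) ε = waveOp ((f : Param → Rd d × ℝ → 𝕜) ε) := by
    ext z
    simp [n, waveOp, netDeriv_top]
  simpa only [hval] using hn K hK (by simp) l

variable (hnull : ∀ v : P.moderate (⊤ : Opens (Rd d)), v ∈ P.negligible ⊤ →
  TendstoDistr ⊤ (v : Param → Rd d → 𝕜) 0)

include hnull

lemma IsWaveSolution.tendsto_sub_integral_wronskian (hu : IsWaveSolution (cls f) u₀ u₁)
    {W : Rd d × ℝ → ℝ} (hW : ContDiff ℝ 2 W) (hwave : waveOp W = 0) (hWc : SpatiallyCompact W)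
    (a b : ℝ) :
    Tendsto (fun ε => (∫ x, wronskian timeVec W ((f : Param → Rd d × ℝ → 𝕜) ε) (x, b)) -
      ∫ x, wronskian timeVec W ((f : Param → Rd d × ℝ → 𝕜) ε) (x, a)) atBot (𝓝 0) := by
  obtain ⟨C, K, hK, hbound⟩ := exists_norm_sub_integral_wronskian_le (G := 𝕜) hW hwave hWc a b
  have hsmooth (ε) := contDiff_of_moderate f ε
  have hnorm (ε) (z) (hz : z ∈ K) : ‖waveOp ((f : Param → Rd d × ℝ → 𝕜) ε) z‖ ≤
      ckSeminorm (⊤ : Opens (Rd d × ℝ)) K 0 (waveOp ((f : Param → Rd d × ℝ → 𝕜) ε)) := by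
    have hle := le_ckSeminorm (Ω := ⊤) (contDiff_waveOp (m := ∞) (hsmooth ε) le_rfl).contDiffOn hK
      (subset_univ K) hz (Nat.zero_le 0)
    rwa [norm_iteratedFDerivWithin_zero] at hle
  refine squeeze_zero_norm (fun ε => hbound _ _ (contDiff_infty.1 (hsmooth ε) 2) (hnorm ε)) ?_
  simpa only [mul_zero] using (tendsto_zero_of_mem_absI hnull
    (hu.ckSeminorm_waveOp_mem_absI hK 0)).const_mul C

lemma IsWaveSolution.exists_tendsto_integral_slice (hu : IsWaveSolution (cls f) u₀ u₁)
    {r : ℝ≥0} {x : Rd d} {R t : ℝ}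
    (h₀ : ∀ y ∈ Metric.closedBall x (R + |t|), r ∈ regularExponents u₀ y)
    (h₁ : ∀ y ∈ Metric.closedBall x (R + |t|), r ∈ regularExponents u₁ y)
    {ψ : Rd d → ℝ} (hψ : ContDiff ℝ ∞ ψ) (hR : ∀ y, R < ‖y - x‖ → ψ y = 0) :
    ∃ l, Tendsto (fun ε : Param => ∫ y, ψ y • scale r ε • (f : Param → Rd d × ℝ → 𝕜) ε (y, t))
      atBot (𝓝 l) := by
  obtain ⟨W, hW, hwave, hW0, hW1, hWR⟩ := exists_waveOp_eq_zero_of_data hψ hR t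
  have hWc := spatiallyCompact_of_cone hWR
  have hdW : ContDiff ℝ ∞ (dirDeriv timeVec W) := contDiff_dirDeriv hW le_rfl _
  have hslice {F : Rd d × ℝ → ℝ} (hF : ContDiff ℝ ∞ F) : ContDiff ℝ ∞ fun y => F (y, 0) :=
    hF.comp (contDiff_id.prodMk contDiff_const)
  obtain rfl : cls (netSlice 0 f) = u₀ := hu.init
  obtain rfl : cls (netSlice 0 (netDeriv timeVec f)) = u₁ := hu.init_deriv
  rw [← abs_neg t, ← zero_sub] at h₀ h₁
  obtain ⟨l₀, hl₀⟩ := exists_tendsto_integral_of_regular hnull (hslice hdW)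
    ((hWc.dirDeriv timeVec).hasCompactSupport_slice 0) fun y hy =>
      h₀ y (tsupport_slice_subset_closedBall (dirDeriv_eq_zero_of_cone hWR timeVec) 0 hy)
  obtain ⟨l₁, hl₁⟩ := exists_tendsto_integral_of_regular hnull (hslice hW)
    (hWc.hasCompactSupport_slice 0) fun y hy => h₁ y (tsupport_slice_subset_closedBall hWR 0 hy)
  have hlim := (hl₀.sub hl₁).sub (tendsto_scale_smul_zero r
    (hu.tendsto_sub_integral_wronskian hnull (contDiff_infty.1 hW 2) hwave hWc 0 t))
  refine ⟨_, hlim.congr fun ε => ?_⟩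
  have hvelocity (y) : (netSlice 0 (netDeriv timeVec f) : Param → Rd d → 𝕜) ε y =
      dirDeriv timeVec ((f : Param → Rd d × ℝ → 𝕜) ε) (y, 0) :=
    congrFun (netDeriv_top timeVec f ε) (y, 0)
  have hposition (y) : (netSlice 0 f : Param → Rd d → 𝕜) ε y =
      (f : Param → Rd d × ℝ → 𝕜) ε (y, 0) := rfl
  have hduality := integral_smul_slice_eq_sub_wronskian (contDiff_infty.1 hW 1) hWc hW0 hW1
    (contDiff_infty.1 (contDiff_of_moderate f ε) 1) 0
  simp only [hvelocity, hposition, smul_comm _ (scale r ε), integral_smul, ← smul_sub, hduality]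

lemma IsWaveSolution.mem_regularExponents_slice {u : P.GenFun (⊤ : Opens (Rd d × ℝ))}
    (hu : IsWaveSolution u u₀ u₁) {r : ℝ≥0} {x : Rd d} {t : ℝ}
    (h₀ : ∀ y ∈ Metric.closedBall x |t|, r ∈ regularExponents u₀ y)
    (h₁ : ∀ y ∈ Metric.closedBall x |t|, r ∈ regularExponents u₁ y) :
    r ∈ regularExponents (slice t u) x := by
  obtain ⟨f, rfl⟩ : ∃ f : P.moderate ⊤, cls f = u := Ideal.Quotient.mk_surjective u
  obtain ⟨δ, hδ, hsub⟩ := (isCompact_closedBall x |t|).exists_cthickening_subset_open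
    ((isOpen_setOf_mem_regularExponents u₀ r).inter (isOpen_setOf_mem_regularExponents u₁ r))
    fun y hy => ⟨h₀ y hy, h₁ y hy⟩
  rw [cthickening_closedBall hδ.le (abs_nonneg t)] at hsub
  let V : Opens (Rd d) := ⟨Metric.ball x δ, Metric.isOpen_ball⟩
  refine ⟨netSlice t f, (slice_cls t f).symm, V, Metric.mem_ball_self hδ, le_top, ?_⟩
  refine exists_distribution_of_tendsto_integral (fun ε =>
    ((contDiff_of_moderate (netSlice t f) ε).continuous.const_smul _).continuousOn
      |>.locallyIntegrableOn V.isOpen.measurableSet) fun ψ => ?_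
  refine hu.exists_tendsto_integral_slice hnull (fun y hy => (hsub hy).1) (fun y hy => (hsub hy).2)
    ψ.contDiff fun y hy => image_eq_zero_of_notMem_tsupport fun hmem => ?_
  exact hy.not_gt (mem_ball_iff_norm.1 (ψ.tsupport_subset hmem))

end SolidPair

end Propagation

end CEP

end

theorem mainTheorem9_general {𝕜 : Type*} [RCLike 𝕜] {d : ℕ} {P : CEP.SolidPair 𝕜}
    (hnull : ∀ v : P.moderate (⊤ : Opens (CEP.Rd d)), v ∈ P.negligible ⊤ →
      CEP.TendstoDistr ⊤ (v : CEP.Param → CEP.Rd d → 𝕜) 0)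
    {u₀ u₁ : P.GenFun (⊤ : Opens (CEP.Rd d))} {u : P.GenFun (⊤ : Opens (CEP.Rd d × ℝ))}
    (hu : CEP.SolidPair.IsWaveSolution u u₀ u₁) (t : ℝ) :
    CEP.SolidPair.singularSpectrum (CEP.SolidPair.slice t u) ⊆
      {p | ∃ y ∈ Metric.closedBall p.1 |t|, (y, p.2) ∈
        CEP.SolidPair.singularSpectrum u₀ ∪ CEP.SolidPair.singularSpectrum u₁} := by
  rintro ⟨x, r⟩ ⟨-, hsing⟩
  by_contra hregular
  refine hsing (hu.mem_regularExponents_slice hnull (fun y hy => ?_) fun y hy => ?_)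
  · by_contra hy₀
    exact hregular ⟨y, hy, Or.inl ⟨trivial, hy₀⟩⟩
  · by_contra hy₁
    exact hregular ⟨y, hy, Or.inr ⟨trivial, hy₁⟩⟩

theorem mainTheorem9 {𝕜 : Type*} [RCLike 𝕜] (d : ℕ) (P : CEP.SolidPair 𝕜)
    (hscale : ∀ r : ℝ≥0, (fun ε : CEP.Param => ((CEP.scale r ε : ℝ) : 𝕜)) ∈ P.A)
    (hnull : ∀ V : Opens (CEP.Rd d), ∀ v : P.moderate V, v ∈ P.negligible V →
      CEP.TendstoDistr V (v : CEP.Param → CEP.Rd d → 𝕜) 0)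
    (u₀ u₁ : P.GenFun (⊤ : Opens (CEP.Rd d)))
    (u : P.GenFun (⊤ : Opens (CEP.Rd d × ℝ)))
    (hu : CEP.SolidPair.IsWaveSolution u u₀ u₁)
    (I : Set ℝ≥0)
    (hI : I = ∅ ∨ (∃ r : ℝ≥0∞, I = {s : ℝ≥0 | (s : ℝ≥0∞) < r}) ∨
      ∃ r : ℝ≥0∞, I = {s : ℝ≥0 | (s : ℝ≥0∞) ≤ r})
    (h₀ : CEP.SolidPair.singularSpectrum u₀ ⊆ Set.univ ×ˢ I)
    (h₁ : CEP.SolidPair.singularSpectrum u₁ ⊆ Set.univ ×ˢ I)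
    (t : ℝ) :
    CEP.SolidPair.singularSpectrum (CEP.SolidPair.slice t u) ⊆ Set.univ ×ˢ I := by
  rintro p hp
  obtain ⟨y, -, hy | hy⟩ := mainTheorem9_general (hnull ⊤) hu t hp
  exacts [⟨trivial, (h₀ hy).2⟩, ⟨trivial, (h₁ hy).2⟩]
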